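/- **Theorem (C\*-case of the Main Theorem).** Let $\Gamma$ be a discrete group with the approximation property (AP) of Haagerup and Kraus, that is, there is a net of finitely supported functions on $\Gamma$ converging to the constant function $1$ in the weak\* topology $\sigma(M_0A(\Gamma),Q(\Gamma))$, where $M_0A(\Gamma)$ is the space of completely bounded Fourier multipliers of $\Gamma$ and its predual $Q(\Gamma)$ is the completion of $\ell^1(\Gamma)$ for the norm $\|f\|_Q=\sup\{|\sum_s f(s)\varphi(s)| : \|\varphi\|_{M_0A(\Gamma)}\le 1\}$. Let $\Gamma$ act freely by homeomorphisms on locally compact Hausdorff spaces $X$ and $Y$, and let $\pi\colon Y\to X$ be a proper factor map, i.e. a $\Gamma$-equivariant quotient map such that preimages of compact sets are compact. Regard $C_0(X)$ as a $\Gamma$-C\*-subalgebra of $C_0(Y)$ via $f\mapsto f\circ\pi$. An intermediate extension of $\pi$ consists of an action of $\Gamma$ by homeomorphisms on a locally compact Hausdorff space $Z$ and equivariant quotient maps $p\colon Y\to Z$, $q\colon Z\to X$ with $q\circ p=\pi$; then $p$ is automatically proper, and $C_0(Z)$ is regarded as a $\Gamma$-C\*-subalgebra of $C_0(Y)$ via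 $f\mapsto f\circ p$, so that $C_0(X)\subseteq C_0(Z)\subseteq C_0(Y)$. Two intermediate extensions $(Z,p,q)$, $(Z',p',q')$ are identified if there is a $\Gamma$-equivariant homeomorphism $h\colon Z\to Z'$ with $h\circ p=p'$ and $q=q'\circ h$. By Gelfand duality, $Z\mapsto C_0(Z)$ is a bijection from the set of classes of intermediate extensions onto the set of $\Gamma$-invariant C\*-subalgebras of $C_0(Y)$ containing $C_0(X)$, and the former set carries the lattice structure induced by this bijection. Lattices of C\*-subalgebras carry the operations $C\vee D=C^*(C,D)$ (the C\*-subalgebra generated by $C$ and $D$) and $C\wedge D=C\cap D$. Then the map $$C_0(Z)\longmapsto C_0(Z)\rtimes_r\Gamma$$ is well defined on classes and is a lattice isomorphism from the lattice of intermediate extensions $Z$ of $\pi$ onto the lattice of all C\*-algebras $A$ with $C_0(X)\rtimes_r\Gamma\subseteq A\subseteq C_0(Y)\rtimes_r\Gamma$. Here $\rtimes_r$ denotes the reduced crossed product. -/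

import Mathlib

namespace CrossedExt

open Topology Filter
open scoped ENNReal ZeroAtInfty

noncomputable section

/-! ### Operators on `ℓ²(Γ, H)` -/

/-- The Hilbert space `ℓ²(ι, H) = ℓ²(ι) ⊗ H`. -/
abbrev L2 (ι H : Type*) [NormedAddCommGroup H] : Type _ := lp (fun _ : ι => H) 2

/-- The left translation `λ_s ⊗ 1` on `ℓ²(Γ, H)`: `(λ_s ξ)(t) = ξ (s⁻¹ t)`. -/
def translation {Γ H : Type*} [Group Γ] [NormedAddCommGroup H] [NormedSpace ℂ H] (s : Γ) :
    L2 Γ H →L[ℂ] L2 Γ H :=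
  LinearMap.mkContinuous
    { toFun := fun ξ => ⟨fun t => ξ (s⁻¹ * t), memℓp_gen (by
        have h := (memℓp_gen_iff (p := 2) (by simp)).1 (lp.memℓp ξ)
        exact (Equiv.mulLeft s⁻¹).summable_iff.2 h)⟩
      map_add' := fun _ _ => rfl
      map_smul' := fun _ _ => rfl } 1 (fun ξ => by
    rw [one_mul]
    refine le_of_eq ?_
    have h2 : (0 : ℝ) < (2 : ℝ≥0∞).toReal := by simp
    refine (Real.rpow_left_inj (norm_nonneg _) (norm_nonneg _) h2.ne').1 ?_
    rw [lp.norm_rpow_eq_tsum h2, lp.norm_rpow_eq_tsum h2]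
    exact (Equiv.mulLeft s⁻¹).tsum_eq (fun t => ‖ξ t‖ ^ (2 : ℝ≥0∞).toReal))

/-! ### The approximation property of Haagerup and Kraus -/

/-- The operator `T ⊗ λ_s` on `ℂⁿ ⊗ ℓ²(Γ) = ℓ²(Γ, ℂⁿ)`. -/
def tensorTranslation {Γ : Type*} [Group Γ] {n : ℕ}
    (T : EuclideanSpace ℂ (Fin n) →L[ℂ] EuclideanSpace ℂ (Fin n)) (s : Γ) :
    L2 Γ (EuclideanSpace ℂ (Fin n)) →L[ℂ] L2 Γ (EuclideanSpace ℂ (Fin n)) :=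
  (lp.mapCLM 2 (fun _ : Γ => T) (norm_nonneg T) (fun _ => le_rfl)) ∘L translation s

/-- The Fourier multiplier `λ_s ↦ φ(s) λ_s` of the reduced group C*-algebra of `Γ` is completely
bounded with completely bounded norm at most `C`: for every `n`, its amplification to
`M_n(ℂ) ⊗ ℂ[Γ]`, acting on `ℂⁿ ⊗ ℓ²(Γ)`, has norm at most `C`. -/
def IsCBMultiplierWith {Γ : Type*} [Group Γ] (φ : Γ → ℂ) (C : ℝ) : Prop :=
  ∀ (n : ℕ) (b : Γ →₀ (EuclideanSpace ℂ (Fin n) →L[ℂ] EuclideanSpace ℂ (Fin n))),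
    ‖b.sum fun s T => φ s • tensorTranslation T s‖ ≤ C * ‖b.sum fun s T => tensorTranslation T s‖

/-- The space `M₀A(Γ)` of completely bounded Fourier multipliers (Herz–Schur multipliers). -/
def cbMultipliers (Γ : Type*) [Group Γ] : Submodule ℂ (Γ → ℂ) where
  carrier := {φ | ∃ C, IsCBMultiplierWith φ C}
  zero_mem' := ⟨0, fun n b => by simp [Finsupp.sum]⟩
  add_mem' := by
    rintro φ ψ ⟨C, hC⟩ ⟨D, hD⟩
    refine ⟨C + D, fun n b => ?_⟩
    have : (b.sum fun s T => (φ + ψ) s • tensorTranslation T s) =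
        (b.sum fun s T => φ s • tensorTranslation T s) +
          b.sum fun s T => ψ s • tensorTranslation T s := by
      simp [Finsupp.sum, add_smul, Finset.sum_add_distrib]
    rw [this, add_mul]
    exact (norm_add_le _ _).trans (add_le_add (hC n b) (hD n b))
  smul_mem' := by
    rintro c φ ⟨C, hC⟩
    refine ⟨‖c‖ * C, fun n b => ?_⟩
    have : (b.sum fun s T => (c • φ) s • tensorTranslation T s) =
        c • (b.sum fun s T => φ s • tensorTranslation T s) := by
      simp [Finsupp.sum, mul_smul, Finset.smul_sum]
    rw [this, norm_smul, mul_assoc]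
    exact mul_le_mul_of_nonneg_left (hC n b) (norm_nonneg c)

/-- The constant function `1`, as a completely bounded multiplier. -/
def cbOne (Γ : Type*) [Group Γ] : cbMultipliers Γ :=
  ⟨fun _ => 1, 1, fun n b => by simp⟩

/-- The elements of the predual `Q(Γ)` of `M₀A(Γ)`, viewed as linear functionals on `M₀A(Γ)`.
By definition `Q(Γ)` is the completion of `ℓ¹(Γ)` for the norm
`‖f‖ = sup {|∑ f(s) φ(s)| : ‖φ‖_{M₀A(Γ)} ≤ 1}`, that is, the norm closure of `ℓ¹(Γ)` in the dual
of `M₀A(Γ)`. -/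
def IsPredualFunctional {Γ : Type*} [Group Γ] (q : cbMultipliers Γ →ₗ[ℂ] ℂ) : Prop :=
  ∀ ε > (0 : ℝ), ∃ f : Γ → ℂ, Summable (fun s => ‖f s‖) ∧
    ∀ (φ : cbMultipliers Γ) (C : ℝ), IsCBMultiplierWith (φ : Γ → ℂ) C →
      ‖q φ - ∑' s, f s * (φ : Γ → ℂ) s‖ ≤ ε * C

/-- The approximation property (AP) of Haagerup and Kraus for a discrete group: there is a net
(here: a proper filter) of finitely supported functions which converges to the constant
function `1` in the weak* topology `σ(M₀A(Γ), Q(Γ))`. -/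
def HasAP (Γ : Type*) [Group Γ] : Prop :=
  ∃ l : Filter (cbMultipliers Γ), l.NeBot ∧
    (∀ᶠ φ in l, (Function.support φ.1).Finite) ∧
    ∀ q : cbMultipliers Γ →ₗ[ℂ] ℂ, IsPredualFunctional q → Tendsto q l (𝓝 (q (cbOne Γ)))

/-! ### The lattice of C*-subalgebras -/

/-- The C*-subalgebras of a C*-algebra `D`: the norm closed (not necessarily unital)
*-subalgebras. -/
def CStarSubalgebra (D : Type*) [NonUnitalCStarAlgebra D] : Type _ :=
  {C : NonUnitalStarSubalgebra ℂ D // IsClosed (C : Set D)}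

namespace CStarSubalgebra

variable {D : Type*} [NonUnitalCStarAlgebra D]

instance : PartialOrder (CStarSubalgebra D) :=
  inferInstanceAs (PartialOrder {C : NonUnitalStarSubalgebra ℂ D // IsClosed (C : Set D)})

/-- The C*-subalgebra generated by a set. -/
def generate (S : Set D) : CStarSubalgebra D :=
  ⟨(NonUnitalStarAlgebra.adjoin ℂ S).topologicalClosure,
    NonUnitalStarSubalgebra.isClosed_topologicalClosure _⟩

theorem generate_le {S : Set D} {C : CStarSubalgebra D} : generate S ≤ C ↔ S ⊆ (C.1 : Set D) :=
  ⟨fun h => ((NonUnitalStarAlgebra.subset_adjoin ℂ S).trans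
      (NonUnitalStarSubalgebra.le_topologicalClosure _)).trans h,
    fun h => NonUnitalStarSubalgebra.topologicalClosure_minimal _
      (NonUnitalStarAlgebra.adjoin_le h) C.2⟩

/-- `A ⊔ B` is the C*-subalgebra generated by `A` and `B`, and `A ⊓ B` is the intersection. -/
instance : Lattice (CStarSubalgebra D) where
  sup A B := generate ((A.1 : Set D) ∪ (B.1 : Set D))
  le_sup_left _ _ := (Set.subset_union_left).trans (generate_le.1 le_rfl)
  le_sup_right _ _ := (Set.subset_union_right).trans (generate_le.1 le_rfl)
  sup_le _ _ _ h₁ h₂ := generate_le.2 (Set.union_subset h₁ h₂)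
  inf A B := ⟨A.1 ⊓ B.1, by
    rw [NonUnitalStarAlgebra.coe_inf]
    exact A.2.inter B.2⟩
  inf_le_left _ _ := fun _ hx => (NonUnitalStarAlgebra.mem_inf.1 hx).1
  inf_le_right _ _ := fun _ hx => (NonUnitalStarAlgebra.mem_inf.1 hx).2
  le_inf _ _ _ h₁ h₂ := fun _ hx => NonUnitalStarAlgebra.mem_inf.2 ⟨h₁ hx, h₂ hx⟩

end CStarSubalgebra

/-! ### Reduced crossed products -/

section CrossedProduct

variable {Γ A H : Type*} [Group Γ] [NonUnitalCStarAlgebra A]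
  [NormedAddCommGroup H] [InnerProductSpace ℂ H] [CompleteSpace H]

/-- For an action `α` of `Γ` on a C*-algebra `A` and a representation `ρ` of `A` on `H`, the
representation of `A` on `ℓ²(Γ, H)` given by `(a ξ)(t) = ρ(α_{t⁻¹}(a)) ξ(t)`. -/
def regularRep (α : Γ → A →⋆ₙₐ[ℂ] A) (ρ : A →⋆ₙₐ[ℂ] (H →L[ℂ] H)) (a : A) :
    L2 Γ H →L[ℂ] L2 Γ H :=
  lp.mapCLM 2 (fun t : Γ => ρ (α t⁻¹ a)) (norm_nonneg a) fun t =>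
    (NonUnitalStarAlgHom.norm_apply_le ρ _).trans (NonUnitalStarAlgHom.norm_apply_le (α t⁻¹) a)

/-- The reduced crossed product `A ⋊_r Γ`, realised on `ℓ²(Γ, H)` through a faithful
representation `ρ` of `A` on a Hilbert space `H`: the C*-algebra generated by the operators
`a u_s`, `a ∈ A`, `s ∈ Γ`, of the regular representation induced by `ρ`. -/
def reducedCrossedProduct (α : Γ → A →⋆ₙₐ[ℂ] A) (ρ : A →⋆ₙₐ[ℂ] (H →L[ℂ] H)) :
    CStarSubalgebra (L2 Γ H →L[ℂ] L2 Γ H) :=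
  CStarSubalgebra.generate (Set.range fun x : A × Γ => regularRep α ρ x.1 * translation x.2)

end CrossedProduct

/-! ### Functions vanishing at infinity -/

section Functions

/-- Composition with a continuous proper map, as a *-homomorphism `C₀(Z) → C₀(Y)`. -/
def pullback {Y Z : Type*} [TopologicalSpace Y] [TopologicalSpace Z] (g : CocompactMap Y Z) :
    C₀(Z, ℂ) →⋆ₙₐ[ℂ] C₀(Y, ℂ) :=
  { ZeroAtInftyContinuousMap.compNonUnitalAlgHom g with
    map_star' := fun _ => rfl }

/-- The action of `Γ` on `C₀(Z)` induced by an action on `Z`: `α_s(f) = f ∘ α_s⁻¹`. -/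
def functionAction (Γ Z : Type*) [Group Γ] [TopologicalSpace Z] [MulAction Γ Z]
    [ContinuousConstSMul Γ Z] (s : Γ) : C₀(Z, ℂ) →⋆ₙₐ[ℂ] C₀(Z, ℂ) :=
  pullback
    { toFun := fun z => s⁻¹ • z
      continuous_toFun := continuous_const_smul s⁻¹
      cocompact_tendsto' := (Homeomorph.smul s⁻¹).isClosedEmbedding.tendsto_cocompact }

/-- The faithful representation of `C₀(Y)` on `ℓ²(Y)` by multiplication. -/
def multiplicationRep (Y : Type*) [TopologicalSpace Y] :
    C₀(Y, ℂ) →⋆ₙₐ[ℂ] (L2 Y ℂ →L[ℂ] L2 Y ℂ) where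
  toFun f := lp.mapCLM 2 (fun y : Y => ContinuousLinearMap.mul ℂ ℂ (f y)) (norm_nonneg f)
    fun y => by
      rw [ContinuousLinearMap.opNorm_mul_apply]
      exact f.toBCF.norm_coe_le_norm y
  map_smul' c f := by
    ext ξ y
    simp [mul_assoc]
  map_zero' := by
    ext ξ y
    simp
  map_add' f g := by
    ext ξ y
    simp
  map_mul' f g := by
    ext ξ y
    simp [mul_assoc]
  map_star' f := by
    rw [ContinuousLinearMap.star_eq_adjoint, ContinuousLinearMap.eq_adjoint_iff]
    intro ξ η
    rw [lp.inner_eq_tsum, lp.inner_eq_tsum]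
    refine tsum_congr fun y => ?_
    simp
    ring

end Functions

/-! ### Extensions of topological dynamical systems -/

/-- A factor map: an equivariant quotient map. -/
structure IsFactorMap (Γ : Type*) {Y X : Type*} [Group Γ] [TopologicalSpace Y] [TopologicalSpace X]
    [MulAction Γ Y] [MulAction Γ X] (π : Y → X) : Prop where
  isQuotientMap : IsQuotientMap π
  map_smul : ∀ (s : Γ) (y : Y), π (s • y) = s • π y

/-- A proper factor map: a factor map such that the preimage of any compact set is compact. -/
structure ProperFactorMap (Γ Y X : Type*) [Group Γ] [TopologicalSpace Y] [TopologicalSpace X]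
    [MulAction Γ Y] [MulAction Γ X] where
  toFun : Y → X
  isFactorMap : IsFactorMap Γ toFun
  isCompact_preimage : ∀ K : Set X, IsCompact K → IsCompact (toFun ⁻¹' K)

section Extensions

universe u v w

variable {Γ : Type u} {Y : Type v} {X : Type w} [Group Γ]
  [TopologicalSpace Y] [MulAction Γ Y]
  [TopologicalSpace X] [MulAction Γ X]

/-- A proper factor map, as a continuous proper map. -/
def ProperFactorMap.toCocompactMap [T2Space X] (π : ProperFactorMap Γ Y X) : CocompactMap Y X where
  toFun := π.toFun
  continuous_toFun := π.isFactorMap.isQuotientMap.continuous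
  cocompact_tendsto' := by
    refine (hasBasis_cocompact.tendsto_right_iff).2 fun K hK => ?_
    exact (π.isCompact_preimage K hK).compl_mem_cocompact

/-- An intermediate extension `Y → Z → X` of an extension `π : Y → X`. -/
structure IntermediateExtension (π : ProperFactorMap Γ Y X) where
  Z : Type v
  [topologicalSpace : TopologicalSpace Z]
  [t2Space : T2Space Z]
  [locallyCompactSpace : LocallyCompactSpace Z]
  [mulAction : MulAction Γ Z]
  [continuousConstSMul : ContinuousConstSMul Γ Z]
  p : Y → Z
  q : Z → X
  isFactorMap_p : IsFactorMap Γ p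
  isFactorMap_q : IsFactorMap Γ q
  comp_eq : ∀ y, q (p y) = π.toFun y

attribute [instance] IntermediateExtension.topologicalSpace IntermediateExtension.t2Space
  IntermediateExtension.locallyCompactSpace IntermediateExtension.mulAction
  IntermediateExtension.continuousConstSMul

namespace IntermediateExtension

variable {π : ProperFactorMap Γ Y X}

/-- Two intermediate extensions are identified if there is a `Γ`-homeomorphism between them that
is compatible with the factor maps. -/
def Equivalent (E F : IntermediateExtension π) : Prop :=
  ∃ h : E.Z ≃ₜ F.Z, (∀ (s : Γ) (z : E.Z), h (s • z) = s • h z) ∧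
    (∀ y, h (E.p y) = F.p y) ∧ ∀ z, E.q z = F.q (h z)

instance setoid (π : ProperFactorMap Γ Y X) : Setoid (IntermediateExtension π) where
  r := Equivalent
  iseqv :=
    { refl := fun E => ⟨Homeomorph.refl _, fun _ _ => rfl, fun _ => rfl, fun _ => rfl⟩
      symm := by
        rintro E F ⟨h, h₁, h₂, h₃⟩
        refine ⟨h.symm, fun s z => ?_, fun y => ?_, fun z => ?_⟩
        · rw [Homeomorph.symm_apply_eq, h₁, Homeomorph.apply_symm_apply]
        · rw [Homeomorph.symm_apply_eq, h₂]
        · rw [h₃, Homeomorph.apply_symm_apply]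
      trans := by
        rintro E F G ⟨h, h₁, h₂, h₃⟩ ⟨k, k₁, k₂, k₃⟩
        refine ⟨h.trans k, fun s z => ?_, fun y => ?_, fun z => ?_⟩
        · simp [h₁, k₁]
        · simp [h₂, k₂]
        · simp [h₃, k₃] }

/-- The factor map `Y → Z` of an intermediate extension of a proper extension is proper. -/
def toCocompactMap (E : IntermediateExtension π) : CocompactMap Y E.Z where
  toFun := E.p
  continuous_toFun := E.isFactorMap_p.isQuotientMap.continuous
  cocompact_tendsto' := by
    refine (hasBasis_cocompact.tendsto_right_iff).2 fun K hK => ?_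
    refine IsCompact.compl_mem_cocompact (s := E.p ⁻¹' K) ?_
    refine (π.isCompact_preimage _
      (hK.image E.isFactorMap_q.isQuotientMap.continuous)).of_isClosed_subset
      (hK.isClosed.preimage E.isFactorMap_p.isQuotientMap.continuous) fun y hy => ?_
    exact ⟨E.p y, hy, E.comp_eq y⟩

end IntermediateExtension

theorem isClosed_range_pullback {Y Z : Type*} [TopologicalSpace Y] [TopologicalSpace Z]
    (g : CocompactMap Y Z) (hg : Function.Surjective g) :
    IsClosed (Set.range (pullback g)) := by
  refine (Isometry.isClosedEmbedding
    (AddMonoidHomClass.isometry_of_norm (pullback g) fun f => ?_)).isClosed_range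
  refine le_antisymm (NonUnitalStarAlgHom.norm_apply_le (pullback g) f) ?_
  rw [← ZeroAtInftyContinuousMap.norm_toBCF_eq_norm]
  refine (BoundedContinuousFunction.norm_le (norm_nonneg _)).2 fun z => ?_
  obtain ⟨y, rfl⟩ := hg z
  exact (pullback g f).toBCF.norm_coe_le_norm y

/-- The C*-subalgebra `C₀(Z) ⊆ C₀(Y)` of functions that factor through a proper surjection
`Y → Z`. -/
def functionAlgebra {Y Z : Type*} [TopologicalSpace Y] [TopologicalSpace Z]
    (g : CocompactMap Y Z) (hg : Function.Surjective g) : CStarSubalgebra C₀(Y, ℂ) :=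
  ⟨NonUnitalStarAlgHom.range (pullback g), isClosed_range_pullback g hg⟩

/-- The intermediate `Γ`-C*-algebras of `C₀(X) ⊆ C₀(Y)`: the `Γ`-invariant C*-subalgebras
of `C₀(Y)` that contain `C₀(X)`. They form a sublattice of the lattice of C*-subalgebras. -/
def intermediateAlgebras [T2Space X] [ContinuousConstSMul Γ Y] (π : ProperFactorMap Γ Y X) :
    Sublattice (CStarSubalgebra C₀(Y, ℂ)) where
  carrier := {A | functionAlgebra π.toCocompactMap π.isFactorMap.isQuotientMap.surjective ≤ A ∧
    ∀ (s : Γ), ∀ a ∈ A.1, functionAction Γ Y s a ∈ A.1}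
  supClosed' := by
    rintro A ⟨hA, hA'⟩ B ⟨hB, hB'⟩
    refine ⟨hA.trans le_sup_left, fun s => ?_⟩
    have hc : Continuous (functionAction Γ Y s) :=
      AddMonoidHomClass.continuous_of_bound _ 1 fun a => by
        simpa using NonUnitalStarAlgHom.norm_apply_le (functionAction Γ Y s) a
    let C : CStarSubalgebra C₀(Y, ℂ) :=
      ⟨(A ⊔ B).1.comap (functionAction Γ Y s), (A ⊔ B).2.preimage hc⟩
    have : A ⊔ B ≤ C := sup_le (fun a ha => le_sup_left (a := A) (b := B) (hA' s a ha))
      (fun a ha => le_sup_right (a := A) (b := B) (hB' s a ha))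
    exact fun a ha => this ha
  infClosed' := by
    rintro A ⟨hA, hA'⟩ B ⟨hB, hB'⟩
    exact ⟨le_inf hA hB, fun s a ha => ⟨hA' s a ha.1, hB' s a ha.2⟩⟩

/-- The intermediate extensions of `π`, up to equivalence. -/
def ExtensionClass (π : ProperFactorMap Γ Y X) : Type (max u (v + 1) w) :=
  Quotient (IntermediateExtension.setoid π)

variable [T2Space X] [ContinuousConstSMul Γ Y]

namespace IntermediateExtension

/-- The intermediate `Γ`-C*-algebra `C₀(X) ⊆ C₀(Z) ⊆ C₀(Y)` of an intermediate extension. -/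
def algebra {π : ProperFactorMap Γ Y X} (E : IntermediateExtension π) : intermediateAlgebras π :=
  ⟨functionAlgebra E.toCocompactMap E.isFactorMap_p.isQuotientMap.surjective, by
    constructor
    · rintro _ ⟨f, rfl⟩
      let q : CocompactMap E.Z X :=
        { toFun := E.q
          continuous_toFun := E.isFactorMap_q.isQuotientMap.continuous
          cocompact_tendsto' := by
            refine (hasBasis_cocompact.tendsto_right_iff).2 fun K hK => ?_
            refine IsCompact.compl_mem_cocompact (s := E.q ⁻¹' K) ?_
            have : E.q ⁻¹' K = E.p '' (π.toFun ⁻¹' K) := by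
              ext z
              obtain ⟨y, rfl⟩ := E.isFactorMap_p.isQuotientMap.surjective z
              constructor
              · exact fun h => ⟨y, by simpa [E.comp_eq] using h, rfl⟩
              · rintro ⟨y', h', e⟩
                rw [← e]
                simpa [E.comp_eq] using h'
            rw [this]
            exact (π.isCompact_preimage K hK).image E.isFactorMap_p.isQuotientMap.continuous }
      refine ⟨pullback q f, ?_⟩
      ext y
      exact congrArg f (E.comp_eq y)
    · rintro s _ ⟨f, rfl⟩
      refine ⟨functionAction Γ E.Z s f, ?_⟩
      ext y
      exact congrArg f (E.isFactorMap_p.map_smul s⁻¹ y).symm⟩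

theorem mem_algebra {π : ProperFactorMap Γ Y X} {E : IntermediateExtension π} {a : C₀(Y, ℂ)} :
    a ∈ E.algebra.1.1 ↔ ∃ f : C₀(E.Z, ℂ), ∀ y, f (E.p y) = a y := by
  constructor
  · rintro ⟨f, rfl⟩
    exact ⟨f, fun _ => rfl⟩
  · rintro ⟨f, hf⟩
    exact ⟨f, ZeroAtInftyContinuousMap.ext hf⟩

theorem algebra_congr {π : ProperFactorMap Γ Y X} {E F : IntermediateExtension π}
    (h : E.Equivalent F) : E.algebra = F.algebra := by
  have key : ∀ E F : IntermediateExtension π, E.Equivalent F → E.algebra ≤ F.algebra := by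
    rintro E F ⟨h, -, h₂, -⟩ a ha
    obtain ⟨f, hf⟩ := mem_algebra.1 ha
    refine mem_algebra.2 ⟨pullback
      { toFun := h.symm
        continuous_toFun := h.symm.continuous
        cocompact_tendsto' := h.symm.isClosedEmbedding.tendsto_cocompact } f, fun y => ?_⟩
    rw [← hf y, ← h₂ y]
    exact congrArg f (h.symm_apply_apply _)
  exact le_antisymm (key E F h) (key F E ((IntermediateExtension.setoid π).symm h))

/-- Points of a locally compact Hausdorff space are separated by `C₀`. -/
theorem exists_zeroAtInfty_ne {Z : Type*} [TopologicalSpace Z] [T2Space Z] [LocallyCompactSpace Z]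
    {z w : Z} (h : z ≠ w) : ∃ f : C₀(Z, ℂ), f z = 1 ∧ f w = 0 := by
  obtain ⟨f, hf₁, hf₀, hfc, -⟩ := exists_continuous_one_zero_of_isCompact
    (isCompact_singleton (x := z)) (isClosed_singleton (x := w)) (by simpa using h)
  refine ⟨⟨⟨fun x => (f x : ℂ), by fun_prop⟩, ?_⟩, ?_, ?_⟩
  · have := (hfc.comp_left (g := fun r : ℝ => (r : ℂ)) (by simp))
    exact this.is_zero_at_infty
  · have := hf₁ (Set.mem_singleton z)
    simpa using congrArg (fun r : ℝ => (r : ℂ)) this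
  · have := hf₀ (Set.mem_singleton w)
    simpa using congrArg (fun r : ℝ => (r : ℂ)) this

theorem exists_map_of_le {π : ProperFactorMap Γ Y X} {E F : IntermediateExtension π}
    (h : E.algebra ≤ F.algebra) : ∃ r : F.Z → E.Z, Continuous r ∧ ∀ y, r (F.p y) = E.p y := by
  have key : ∀ y y', F.p y = F.p y' → E.p y = E.p y' := by
    intro y y' e
    by_contra hne
    obtain ⟨f, h1, h0⟩ := exists_zeroAtInfty_ne hne
    have hm : pullback E.toCocompactMap f ∈ E.algebra.1.1 := mem_algebra.2 ⟨f, fun _ => rfl⟩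
    obtain ⟨g, hg⟩ := mem_algebra.1 (h hm)
    have h2 : f (E.p y) = f (E.p y') := by
      have e1 := hg y
      have e2 := hg y'
      rw [e] at e1
      exact e1.symm.trans e2
    rw [h1, h0] at h2
    exact one_ne_zero h2
  have hs := F.isFactorMap_p.isQuotientMap.surjective
  have hr : ∀ y, E.p (Function.surjInv hs (F.p y)) = E.p y := fun y =>
    key _ _ (Function.surjInv_eq hs _)
  refine ⟨fun z => E.p (Function.surjInv hs z), ?_, hr⟩
  rw [F.isFactorMap_p.isQuotientMap.continuous_iff]
  have : (fun z => E.p (Function.surjInv hs z)) ∘ F.p = E.p := funext hr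
  rw [this]
  exact E.isFactorMap_p.isQuotientMap.continuous

theorem equivalent_of_algebra_eq {π : ProperFactorMap Γ Y X} {E F : IntermediateExtension π}
    (h : E.algebra = F.algebra) : E.Equivalent F := by
  obtain ⟨r, hr, hr'⟩ := exists_map_of_le h.le
  obtain ⟨k, hk, hk'⟩ := exists_map_of_le h.ge
  have hE := E.isFactorMap_p.isQuotientMap.surjective
  have hF := F.isFactorMap_p.isQuotientMap.surjective
  refine ⟨⟨⟨k, r, fun z => ?_, fun z => ?_⟩, hk, hr⟩, fun s z => ?_, hk', fun z => ?_⟩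
  · obtain ⟨y, rfl⟩ := hE z
    rw [hk', hr']
  · obtain ⟨y, rfl⟩ := hF z
    rw [hr', hk']
  · obtain ⟨y, rfl⟩ := hE z
    change k (s • E.p y) = s • k (E.p y)
    rw [← E.isFactorMap_p.map_smul, hk', hk', F.isFactorMap_p.map_smul]
  · obtain ⟨y, rfl⟩ := hE z
    change E.q (E.p y) = F.q (k (E.p y))
    rw [hk', E.comp_eq, F.comp_eq]

/-! #### Every intermediate `Γ`-C*-algebra comes from an intermediate extension -/

/-- The equivalence relation on `Y` defined by a C*-subalgebra of `C₀(Y)`. -/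
def relOf (A : CStarSubalgebra C₀(Y, ℂ)) : Setoid Y where
  r y y' := ∀ a ∈ A.1, a y = a y'
  iseqv := ⟨fun _ _ _ => rfl, fun h a ha => (h a ha).symm,
    fun h h' a ha => (h a ha).trans (h' a ha)⟩

variable [LocallyCompactSpace X]

theorem exists_extension {π : ProperFactorMap Γ Y X} (A : intermediateAlgebras π) :
    ∃ E : IntermediateExtension π, E.algebra = A := by
  obtain ⟨A, hA, hA'⟩ := A
  let Z := Quotient (relOf A)
  let p : Y → Z := Quotient.mk _
  have hp : IsQuotientMap p := isQuotientMap_quot_mk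
  have hpe : ∀ {y y'}, p y = p y' ↔ ∀ a ∈ A.1, a y = a y' := Quotient.eq
  have hXA : ∀ f : C₀(X, ℂ), pullback π.toCocompactMap f ∈ A.1 := fun f => hA ⟨f, rfl⟩
  have hπ : ∀ y y', p y = p y' → π.toFun y = π.toFun y' := by
    intro y y' e
    by_contra hne
    obtain ⟨f, h1, h0⟩ := exists_zeroAtInfty_ne hne
    have h2 : f (π.toFun y) = f (π.toFun y') := hpe.1 e _ (hXA f)
    rw [h1, h0] at h2
    exact one_ne_zero h2
  let q : Z → X := Quotient.lift π.toFun fun y y' h => hπ y y' (Quotient.sound h)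
  have hqp : ∀ y, q (p y) = π.toFun y := fun _ => rfl
  have hqc : Continuous q := hp.continuous_iff.2 π.isFactorMap.isQuotientMap.continuous
  -- elements of `A` descend to `Z`
  have hdesc : ∀ a ∈ A.1, ∃ g : Z → ℂ, Continuous g ∧ ∀ y, g (p y) = a y := by
    intro a ha
    exact ⟨Quotient.lift a fun y y' h => h a ha, hp.continuous_iff.2 (map_continuous a),
      fun _ => rfl⟩
  have : T2Space Z := by
    refine ⟨fun z w hzw => ?_⟩
    obtain ⟨y, rfl⟩ := hp.surjective z
    obtain ⟨y', rfl⟩ := hp.surjective w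
    have := mt hpe.2 hzw
    push Not at this
    obtain ⟨a, ha, hne⟩ := this
    obtain ⟨g, hg, hga⟩ := hdesc a ha
    exact separated_by_continuous hg (by rwa [hga, hga])
  have hqK : ∀ K : Set X, IsCompact K → IsCompact (q ⁻¹' K) := by
    intro K hK
    have : q ⁻¹' K = p '' (π.toFun ⁻¹' K) := by
      ext z
      obtain ⟨y, rfl⟩ := hp.surjective z
      constructor
      · exact fun h => ⟨y, h, rfl⟩
      · rintro ⟨y', h', e⟩
        rw [← e]
        exact h'
    rw [this]
    exact (π.isCompact_preimage K hK).image hp.continuous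
  have : WeaklyLocallyCompactSpace Z := by
    refine ⟨fun z => ?_⟩
    obtain ⟨K, hK, hKz⟩ := exists_compact_mem_nhds (q z)
    exact ⟨q ⁻¹' K, hqK K hK, hqc.continuousAt hKz⟩
  have hact : ∀ (s : Γ) (y y' : Y), p y = p y' → p (s • y) = p (s • y') := by
    intro s y y' e
    refine hpe.2 fun a ha => ?_
    have := hpe.1 e _ (hA' s⁻¹ a ha)
    change a (s⁻¹⁻¹ • y) = a (s⁻¹⁻¹ • y') at this
    rwa [inv_inv] at this
  let _ : MulAction Γ Z :=
    { smul := fun s => Quotient.map (s • ·) fun y y' h =>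
        Quotient.exact (hact s y y' (Quotient.sound h))
      one_smul := by
        rintro ⟨y⟩
        exact congrArg p (one_smul Γ y)
      mul_smul := by
        rintro s t ⟨y⟩
        exact congrArg p (mul_smul s t y) }
  have hps : ∀ (s : Γ) (y : Y), p (s • y) = s • p y := fun _ _ => rfl
  have : ContinuousConstSMul Γ Z :=
    ⟨fun s => hp.continuous_iff.2 (hp.continuous.comp (continuous_const_smul s))⟩
  let E : IntermediateExtension π :=
    { Z := Z
      p := p
      q := q
      isFactorMap_p := ⟨hp, hps⟩
      isFactorMap_q := ⟨IsQuotientMap.of_comp hp.continuous hqc π.isFactorMap.isQuotientMap, by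
        intro s z
        obtain ⟨y, rfl⟩ := hp.surjective z
        exact π.isFactorMap.map_smul s y⟩
      comp_eq := hqp }
  refine ⟨E, Subtype.ext (le_antisymm ?_ ?_)⟩
  · -- the Stone–Weierstrass theorem on the one-point compactification of `Z`
    let T : C(OnePoint Z, ℂ) →ₗ[ℂ] C₀(Y, ℂ) :=
      { toFun := fun g =>
          { toFun := fun y => g (p y : OnePoint Z) - g OnePoint.infty
            continuous_toFun := (g.continuous.comp
              (OnePoint.continuous_coe.comp hp.continuous)).sub continuous_const
            zero_at_infty' := by
              have h1 : Tendsto (fun z : Z => g (z : OnePoint Z)) (coclosedCompact Z)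
                  (𝓝 (g OnePoint.infty)) :=
                OnePoint.continuousAt_infty'.1 g.continuous.continuousAt
              rw [coclosedCompact_eq_cocompact] at h1
              have h2 := h1.comp (cocompact_tendsto E.toCocompactMap)
              have h3 := h2.sub_const (g OnePoint.infty)
              rw [sub_self] at h3
              exact h3 }
        map_add' := fun g h => by
          ext y
          change (g _ + h _) - (g _ + h _) = (g _ - g _) + (h _ - h _)
          ring
        map_smul' := fun c g => by
          ext y
          change c * g _ - c * g _ = c * (g _ - g _)
          ring }
    have hT : ∀ g y, T g y = g (p y : OnePoint Z) - g OnePoint.infty := fun _ _ => rfl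
    have hTc : Continuous T := by
      refine AddMonoidHomClass.continuous_of_bound T 2 fun g => ?_
      rw [← ZeroAtInftyContinuousMap.norm_toBCF_eq_norm]
      refine (BoundedContinuousFunction.norm_le (by positivity)).2 fun y => ?_
      change ‖g (p y : OnePoint Z) - g OnePoint.infty‖ ≤ 2 * ‖g‖
      refine (norm_sub_le _ _).trans ?_
      rw [two_mul]
      exact add_le_add (g.norm_coe_le_norm _) (g.norm_coe_le_norm _)
    let B : StarSubalgebra ℂ C(OnePoint Z, ℂ) :=
      { carrier := {g | T g ∈ A.1}
        mul_mem' := by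
          intro g h hg hh
          have e : T (g * h) = T g * T h + h OnePoint.infty • T g + g OnePoint.infty • T h := by
            ext y
            simp only [ZeroAtInftyContinuousMap.coe_add, ZeroAtInftyContinuousMap.coe_mul,
              ZeroAtInftyContinuousMap.coe_smul, Pi.add_apply, Pi.mul_apply, Pi.smul_apply, hT,
              ContinuousMap.mul_apply, smul_eq_mul]
            ring
          change T (g * h) ∈ A.1
          rw [e]
          exact add_mem (add_mem (mul_mem hg hh) (SMulMemClass.smul_mem _ hg))
            (SMulMemClass.smul_mem _ hh)
        add_mem' := by
          intro g h hg hh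
          change T (g + h) ∈ A.1
          rw [map_add]
          exact add_mem hg hh
        algebraMap_mem' := by
          intro c
          have e : T (algebraMap ℂ _ c) = 0 := by
            ext y
            simp [hT]
          change T (algebraMap ℂ _ c) ∈ A.1
          rw [e]
          exact zero_mem _
        star_mem' := by
          intro g hg
          have e : T (star g) = star (T g) := by
            ext y
            simp [hT]
          change T (star g) ∈ A.1
          rw [e]
          exact star_mem hg }
    have hBc : IsClosed (B : Set C(OnePoint Z, ℂ)) := A.2.preimage hTc
    -- elements of `A` extend to the one-point compactification
    have hext : ∀ a ∈ A.1, ∃ g ∈ B, (∀ y, g (p y : OnePoint Z) = a y) ∧ g OnePoint.infty = 0 := by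
      intro a ha
      obtain ⟨g, hg, hga⟩ := hdesc a ha
      have hg0 : Tendsto g (coclosedCompact Z) (𝓝 0) := by
        rw [coclosedCompact_eq_cocompact, Metric.tendsto_nhds]
        intro ε hε
        have h1 := (Metric.tendsto_nhds.1 (zero_at_infty a)) ε hε
        obtain ⟨K, hK, hKa⟩ := mem_cocompact.1 h1
        refine mem_cocompact.2 ⟨p '' K, hK.image hp.continuous, fun z hz => ?_⟩
        obtain ⟨y, rfl⟩ := hp.surjective z
        have : y ∉ K := fun hy => hz ⟨y, hy, rfl⟩
        change dist (g (p y)) 0 < ε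
        rw [hga]
        exact hKa this
      let G : C(OnePoint Z, ℂ) :=
        { toFun := fun z => OnePoint.elim z 0 g
          continuous_toFun := (OnePoint.continuous_iff _).2 ⟨hg0, hg⟩ }
      have hGp : ∀ y, G (p y : OnePoint Z) = a y := hga
      have hG0 : G OnePoint.infty = 0 := rfl
      refine ⟨G, ?_, hGp, hG0⟩
      have e : T G = a := by
        ext y
        rw [hT, hGp, hG0, sub_zero]
      change T G ∈ A.1
      rwa [e]
    have hsep : B.toSubalgebra.SeparatesPoints := by
      have hinf : ∀ z : Z, ∃ g ∈ B, g (z : OnePoint Z) ≠ g OnePoint.infty := by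
        intro z
        obtain ⟨y, rfl⟩ := hp.surjective z
        obtain ⟨f, hf1, -, hfc, -⟩ := exists_continuous_one_zero_of_isCompact
          (isCompact_singleton (x := π.toFun y)) isClosed_empty (by simp)
        let f' : C₀(X, ℂ) := ⟨⟨fun x => (f x : ℂ), by fun_prop⟩,
          (hfc.comp_left (g := fun r : ℝ => (r : ℂ)) (by simp)).is_zero_at_infty⟩
        obtain ⟨g, hg, hga, hg0⟩ := hext _ (hXA f')
        refine ⟨g, hg, ?_⟩
        rw [hga, hg0]
        have : f (π.toFun y) = 1 := hf1 (Set.mem_singleton _)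
        change ((f (π.toFun y) : ℝ) : ℂ) ≠ 0
        rw [this]
        simp
      intro z w hzw
      induction z using OnePoint.rec with
      | infty =>
        induction w using OnePoint.rec with
        | infty => exact absurd rfl hzw
        | coe w =>
          obtain ⟨g, hg, hne⟩ := hinf w
          exact ⟨g, ⟨g, hg, rfl⟩, hne.symm⟩
      | coe z =>
        induction w using OnePoint.rec with
        | infty =>
          obtain ⟨g, hg, hne⟩ := hinf z
          exact ⟨g, ⟨g, hg, rfl⟩, hne⟩
        | coe w =>
          obtain ⟨y, rfl⟩ := hp.surjective z
          obtain ⟨y', rfl⟩ := hp.surjective w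
          have := mt hpe.2 (fun e => hzw (congrArg _ e))
          push Not at this
          obtain ⟨a, ha, hne⟩ := this
          obtain ⟨g, hg, hga, -⟩ := hext a ha
          exact ⟨g, ⟨g, hg, rfl⟩, by rwa [hga, hga]⟩
    have hB : ∀ g, g ∈ B := by
      intro g
      have h1 := ContinuousMap.starSubalgebra_topologicalClosure_eq_top_of_separatesPoints B hsep
      have h2 : g ∈ B.topologicalClosure := by rw [h1]; trivial
      exact (StarSubalgebra.topologicalClosure_minimal le_rfl hBc) h2
    rintro _ ⟨f, rfl⟩
    let G : C(OnePoint Z, ℂ) :=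
      { toFun := fun z => OnePoint.elim z 0 f
        continuous_toFun := (OnePoint.continuous_iff _).2 ⟨by
          rw [coclosedCompact_eq_cocompact]
          exact zero_at_infty f, map_continuous f⟩ }
    have e : T G = pullback E.toCocompactMap f := by
      ext y
      exact sub_zero _
    have := hB G
    change T G ∈ A.1 at this
    rw [e] at this
    exact this
  · intro a ha
    obtain ⟨g, hg, hga⟩ := hdesc a ha
    refine mem_algebra.2 ⟨⟨⟨g, hg⟩, ?_⟩, hga⟩
    rw [Metric.tendsto_nhds]
    intro ε hε
    have h1 := (Metric.tendsto_nhds.1 (zero_at_infty a)) ε hε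
    obtain ⟨K, hK, hKa⟩ := mem_cocompact.1 h1
    refine mem_cocompact.2 ⟨p '' K, hK.image hp.continuous, fun z hz => ?_⟩
    obtain ⟨y, rfl⟩ := hp.surjective z
    have : y ∉ K := fun hy => hz ⟨y, hy, rfl⟩
    change dist (g (p y)) 0 < ε
    rw [hga]
    exact hKa this

end IntermediateExtension

namespace ExtensionClass

variable [LocallyCompactSpace X]

/-- The bijection `Z ↦ C₀(Z)` of Gelfand duality between the classes of intermediate extensions
and the intermediate `Γ`-C*-algebras of `C₀(X) ⊆ C₀(Y)`. -/
def gelfand (π : ProperFactorMap Γ Y X) : ExtensionClass π ≃ intermediateAlgebras π :=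
  Equiv.ofBijective
    (Quotient.lift IntermediateExtension.algebra fun _ _ => IntermediateExtension.algebra_congr) (by
    constructor
    · rintro ⟨E⟩ ⟨F⟩ h
      exact Quotient.sound (IntermediateExtension.equivalent_of_algebra_eq h)
    · intro A
      obtain ⟨E, hE⟩ := IntermediateExtension.exists_extension A
      exact ⟨Quotient.mk _ E, hE⟩)

/-- The lattice structure on the classes of intermediate extensions induced by Gelfand duality. -/
instance (π : ProperFactorMap Γ Y X) : Lattice (ExtensionClass π) where
  le a b := gelfand π a ≤ gelfand π b
  le_refl _ := le_rfl
  le_trans _ _ _ h₁ h₂ := h₁.trans h₂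
  le_antisymm _ _ h₁ h₂ := (gelfand π).injective (le_antisymm h₁ h₂)
  sup a b := (gelfand π).symm (gelfand π a ⊔ gelfand π b)
  le_sup_left _ _ := by simp
  le_sup_right _ _ := by simp
  sup_le _ _ _ h₁ h₂ := by simpa using ⟨h₁, h₂⟩
  inf a b := (gelfand π).symm (gelfand π a ⊓ gelfand π b)
  inf_le_left _ _ := by simp
  inf_le_right _ _ := by simp
  le_inf _ _ _ h₁ h₂ := by simpa using ⟨h₁, h₂⟩

end ExtensionClass

/-! ### The crossed products attached to an extension -/

/-- The reduced crossed product `C₀(W) ⋊_r Γ` of a factor `g : Y → W` of `Y`, as a C*-subalgebra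
of the operators on `ℓ²(Γ, ℓ²(Y))`; `C₀(W)` is represented faithfully on `ℓ²(Y)` by multiplication
with the functions `f ∘ g`. -/
def factorCrossedProduct (Γ : Type*) {Y W : Type*} [Group Γ] [TopologicalSpace Y]
    [TopologicalSpace W] [MulAction Γ W] [ContinuousConstSMul Γ W] (g : CocompactMap Y W) :
    CStarSubalgebra (L2 Γ (L2 Y ℂ) →L[ℂ] L2 Γ (L2 Y ℂ)) :=
  reducedCrossedProduct (functionAction Γ W) ((multiplicationRep Y).comp (pullback g))

end Extensions

end

end CrossedExt

open CrossedExt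

namespace CrossedExt

open Topology Filter
open scoped ENNReal ZeroAtInfty InnerProductSpace

noncomputable section

/-! ### Translations -/

section Translation

variable {Γ H : Type*} [Group Γ] [NormedAddCommGroup H] [InnerProductSpace ℂ H]

/-! The inverse of C ↦ C ⋊_r Γ is A ↦ A ∩ C₀(Y), called `functionsIn`. All crossed products are
realised on ℓ²(Γ, ℓ²(Y)), generated by products f u_s with f in a subalgebra of C₀(Y)
(`factorCrossedProduct_eq`). Both maps respect inclusions, so it suffices that they are mutually
inverse.

Recovering C from C ⋊_r Γ needs only that the coefficient maps ∑ b_s u_s ↦ b_s are contractive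
(`norm_coeff_le`) and that finite sums with coefficients in C are dense.

Recovering A has two ingredients. Freeness on X places the Fourier coefficients of each a ∈ A in A
(`exists_mem_near_coeff`): choose self-adjoint p_i ∈ C₀(X) such that ∑ p_i² is nearly a unit for a
given function and p_i α_t(p_i) = 0 for finitely many prescribed t ≠ 1. Then ∑ p_i a u_s* p_i nearly
isolates the s-th coefficient, and each summand p_i · a · (p_i u_s)* lies in A even if u_s does not.

The AP then rebuilds a from its coefficients (`HasAP.mem_crossed`). Let M_φ multiply the s-th
coefficient by φ(s). If a functional ω kills the crossed product of A ∩ C₀(Y), then φ ↦ ω(M_φ a)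
lies in Q(Γ) and vanishes on finitely supported φ, hence at φ = 1, where its value is ω(a).
Hahn–Banach concludes. The boundedness of M_φ comes from viewing a completely bounded Fourier
multiplier as a Schur multiplier (`IsCBMultiplierWith.norm_matrix_le`). -/

@[simp]
theorem translation_apply (s : Γ) (ξ : L2 Γ H) (t : Γ) : translation s ξ t = ξ (s⁻¹ * t) := rfl

theorem translation_one : (translation 1 : L2 Γ H →L[ℂ] L2 Γ H) = 1 := by
  ext ξ t
  simp

theorem translation_mul (s t : Γ) :
    (translation s * translation t : L2 Γ H →L[ℂ] L2 Γ H) = translation (s * t) := by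
  ext ξ r
  simp [mul_assoc]

theorem star_translation [CompleteSpace H] (s : Γ) :
    star (translation s : L2 Γ H →L[ℂ] L2 Γ H) = translation s⁻¹ := by
  symm
  rw [ContinuousLinearMap.star_eq_adjoint, ContinuousLinearMap.eq_adjoint_iff]
  intro ξ η
  rw [lp.inner_eq_tsum, lp.inner_eq_tsum, ← (Equiv.mulLeft s⁻¹).tsum_eq]
  simp

theorem translation_mem_unitary [CompleteSpace H] (s : Γ) :
    (translation s : L2 Γ H →L[ℂ] L2 Γ H) ∈ unitary (L2 Γ H →L[ℂ] L2 Γ H) := by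
  rw [Unitary.mem_iff, star_translation, translation_mul, translation_mul]
  simp [translation_one]

theorem norm_mul_translation [CompleteSpace H] (x : L2 Γ H →L[ℂ] L2 Γ H) (s : Γ) :
    ‖x * translation s‖ = ‖x‖ :=
  CStarRing.norm_mul_mem_unitary x (translation_mem_unitary s)

end Translation

/-! ### Completely bounded multipliers act as Schur multipliers -/

section Schur

variable {Γ : Type*} [Group Γ] {n : ℕ}

local notation "𝓔" n => EuclideanSpace ℂ (Fin n)

@[simp]
theorem tensorTranslation_apply (T : (𝓔 n) →L[ℂ] 𝓔 n) (s : Γ) (ξ : L2 Γ (𝓔 n)) (t : Γ) :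
    tensorTranslation T s ξ t = T (ξ (s⁻¹ * t)) := rfl

theorem tensorTranslation_mul (S T : (𝓔 n) →L[ℂ] 𝓔 n) (s t : Γ) :
    tensorTranslation S s * tensorTranslation T t = tensorTranslation (S * T) (s * t) := by
  ext ξ r i
  simp [mul_assoc]

theorem star_tensorTranslation (T : (𝓔 n) →L[ℂ] 𝓔 n) (s : Γ) :
    star (tensorTranslation T s) = tensorTranslation (star T) s⁻¹ := by
  symm
  rw [ContinuousLinearMap.star_eq_adjoint (tensorTranslation T s),
    ContinuousLinearMap.eq_adjoint_iff]
  intro ξ η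
  rw [lp.inner_eq_tsum, lp.inner_eq_tsum, ← (Equiv.mulLeft s⁻¹).tsum_eq]
  simp [ContinuousLinearMap.star_eq_adjoint, ContinuousLinearMap.adjoint_inner_left]

/-- `T ↦ T ⊗ λ_s` as a linear map. -/
def tensorTranslationₗ (s : Γ) :
    ((𝓔 n) →L[ℂ] 𝓔 n) →ₗ[ℂ] (L2 Γ (𝓔 n) →L[ℂ] L2 Γ (𝓔 n)) where
  toFun T := tensorTranslation T s
  map_add' S T := by ext ξ r i; simp
  map_smul' c T := by ext ξ r i; simp

@[simp]
theorem tensorTranslationₗ_apply (s : Γ) (T : (𝓔 n) →L[ℂ] 𝓔 n) :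
    tensorTranslationₗ s T = tensorTranslation T s := rfl

theorem tensorTranslation_one_one : tensorTranslation (1 : (𝓔 n) →L[ℂ] 𝓔 n) (1 : Γ) = 1 := by
  ext ξ r i
  simp

theorem norm_tensorTranslation_one (T : (𝓔 n) →L[ℂ] 𝓔 n) :
    ‖tensorTranslation T (1 : Γ)‖ = ‖T‖ := by
  classical
  have h1 : (translation 1 : L2 Γ (𝓔 n) →L[ℂ] L2 Γ (𝓔 n)) = 1 := translation_one
  refine le_antisymm ?_ ?_
  · rw [tensorTranslation, h1]
    exact lp.norm_mapCLM_le 2 _ (norm_nonneg T) fun _ => le_rfl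
  · refine ContinuousLinearMap.opNorm_le_bound _ (norm_nonneg _) fun x => ?_
    -- Vectors supported at the identity form an isometric copy of ℂⁿ on which T ⊗ 1 acts as T.
    have h2 : tensorTranslation T (1 : Γ) (lp.single 2 1 x) = lp.single 2 1 (T x) := by
      ext r i
      rw [tensorTranslation_apply, inv_one, one_mul, lp.single_apply, lp.single_apply]
      by_cases hr : r = 1
      · subst hr
        simp
      · simp [hr]
    have h3 := (tensorTranslation T (1 : Γ)).le_opNorm (lp.single 2 1 x)
    rwa [h2, lp.norm_single (by simp), lp.norm_single (by simp)] at h3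

/-- The `i`-th coordinate projection of `ℂⁿ`. -/
def coordProj (i : Fin n) : (𝓔 n) →L[ℂ] 𝓔 n :=
  (EuclideanSpace.proj i : (𝓔 n) →L[ℂ] ℂ).smulRight (EuclideanSpace.single i (1 : ℂ))

theorem coordProj_apply (i j : Fin n) (x : 𝓔 n) : coordProj i x j = if j = i then x i else 0 := by
  simp [coordProj]

theorem sum_coordProj : ∑ i : Fin n, coordProj i = 1 := by
  ext x j
  simp [coordProj_apply]

theorem coordProj_mul_self (i : Fin n) : coordProj i * coordProj i = coordProj i := by
  ext x j
  simp [coordProj_apply]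

theorem coordProj_mul_of_ne {i j : Fin n} (h : i ≠ j) : coordProj i * coordProj j = 0 := by
  ext x k
  simp [coordProj_apply, h]

theorem star_coordProj (i : Fin n) : star (coordProj i) = coordProj i := by
  symm
  rw [ContinuousLinearMap.star_eq_adjoint, ContinuousLinearMap.eq_adjoint_iff]
  intro x y
  simp [PiLp.inner_apply, coordProj_apply, apply_ite (starRingEnd ℂ)]

/-- The unitary `∑ᵢ eᵢᵢ ⊗ λ_{gᵢ}` on `ℂⁿ ⊗ ℓ²(Γ)`. -/
def diagTranslation (g : Fin n → Γ) : L2 Γ (𝓔 n) →L[ℂ] L2 Γ (𝓔 n) :=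
  ∑ i, tensorTranslation (coordProj i) (g i)

theorem star_diagTranslation (g : Fin n → Γ) :
    star (diagTranslation g) = diagTranslation fun i => (g i)⁻¹ := by
  simp [diagTranslation, star_sum, star_tensorTranslation, star_coordProj]

/-- The coordinate projections are mutually orthogonal with sum 1, so only the terms eᵢᵢ ⊗ λ₁
survive. -/
theorem diagTranslation_mul_inv (g : Fin n → Γ) :
    diagTranslation g * diagTranslation (fun i => (g i)⁻¹) = 1 := by
  have h : ∀ i j, tensorTranslation (coordProj i) (g i) * tensorTranslation (coordProj j) (g j)⁻¹ =
      if j = i then tensorTranslationₗ (1 : Γ) (coordProj i) else 0 := by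
    intro i j
    rw [tensorTranslation_mul]
    split_ifs with hij
    · subst hij
      simp [coordProj_mul_self]
    · rw [coordProj_mul_of_ne (Ne.symm hij)]
      exact map_zero (tensorTranslationₗ _)
  simp only [diagTranslation, Finset.sum_mul_sum, h, Finset.sum_ite_eq',
    Finset.mem_univ, if_true]
  rw [← map_sum, sum_coordProj]
  exact tensorTranslation_one_one

theorem diagTranslation_mem_unitary (g : Fin n → Γ) :
    diagTranslation g ∈ unitary (L2 Γ (𝓔 n) →L[ℂ] L2 Γ (𝓔 n)) := by
  rw [Unitary.mem_iff, star_diagTranslation]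
  refine ⟨?_, diagTranslation_mul_inv g⟩
  simpa using diagTranslation_mul_inv fun i => (g i)⁻¹

/-- The bridge from Fourier to Schur multipliers: conjugating M ⊗ 1 by this unitary attaches λ at
gᵢgⱼ⁻¹ to the (i, j) entry, so the Fourier multiplier φ scales that entry by φ(gᵢgⱼ⁻¹). -/
theorem diagTranslation_conj (g : Fin n → Γ) (M : (𝓔 n) →L[ℂ] 𝓔 n) :
    diagTranslation g * tensorTranslation M 1 * diagTranslation (fun i => (g i)⁻¹) =
      ∑ i, ∑ j, tensorTranslation (coordProj i * M * coordProj j) (g i * (g j)⁻¹) := by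
  simp [diagTranslation, Finset.sum_mul, Finset.mul_sum, tensorTranslation_mul]
  rw [Finset.sum_comm]

theorem norm_sum_tensorTranslation (g : Fin n → Γ) (M : (𝓔 n) →L[ℂ] 𝓔 n) :
    ‖∑ i, ∑ j, tensorTranslation (coordProj i * M * coordProj j) (g i * (g j)⁻¹)‖ = ‖M‖ := by
  rw [← diagTranslation_conj, ← star_diagTranslation,
    CStarRing.norm_mul_mem_unitary _ (Unitary.star_mem (diagTranslation_mem_unitary g)),
    CStarRing.norm_mem_unitary_mul _ (diagTranslation_mem_unitary g), norm_tensorTranslation_one]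

/-- The multiplier sends the conjugate of M ⊗ 1 to that of M' ⊗ 1, and conjugation preserves both
norms. -/
theorem IsCBMultiplierWith.norm_matrix_le {φ : Γ → ℂ} {C : ℝ} (hφ : IsCBMultiplierWith φ C)
    (g : Fin n → Γ) {M M' : (𝓔 n) →L[ℂ] 𝓔 n}
    (h : ∀ i j, coordProj i * M' * coordProj j =
      φ (g i * (g j)⁻¹) • (coordProj i * M * coordProj j)) : ‖M'‖ ≤ C * ‖M‖ := by
  classical
  -- Different pairs (i, j) may give the same group element, so b is assembled additively and
  -- evaluated by linearity.
  let b : Γ →₀ ((𝓔 n) →L[ℂ] 𝓔 n) :=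
    ∑ i, ∑ j, Finsupp.single (g i * (g j)⁻¹) (coordProj i * M * coordProj j)
  have key : ∀ ψ : Γ → ℂ, (b.sum fun s T => ψ s • tensorTranslation T s) =
      ∑ i, ∑ j, ψ (g i * (g j)⁻¹) •
        tensorTranslation (coordProj i * M * coordProj j) (g i * (g j)⁻¹) := by
    intro ψ
    have h2 : ∀ b : Γ →₀ ((𝓔 n) →L[ℂ] 𝓔 n), (b.sum fun s T => ψ s • tensorTranslation T s) =
        Finsupp.lsum ℂ (fun s => ψ s • tensorTranslationₗ (n := n) s) b := fun b => rfl
    rw [h2]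
    simp only [b, map_sum, Finsupp.lsum_single]
    rfl
  have h1 := hφ n b
  have h2 := key fun _ => 1
  simp only [one_smul] at h2
  rw [key, h2, norm_sum_tensorTranslation] at h1
  rw [← norm_sum_tensorTranslation g M']
  refine le_trans (le_of_eq ?_) h1
  congr 1
  refine Finset.sum_congr rfl fun i _ => Finset.sum_congr rfl fun j _ => ?_
  rw [h]
  exact map_smul (tensorTranslationₗ _) _ _

theorem IsCBMultiplierWith.nonneg {φ : Γ → ℂ} {C : ℝ} (hφ : IsCBMultiplierWith φ C) : 0 ≤ C := by
  -- Dimension 1 matters: in dimension 0 all operators vanish and C is unconstrained.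
  have h := hφ 1 (Finsupp.single 1 1)
  rw [Finsupp.sum_single_index, Finsupp.sum_single_index, norm_tensorTranslation_one] at h
  · rw [norm_one, mul_one] at h
    exact (norm_nonneg _).trans h
  · exact map_zero (tensorTranslationₗ _)
  · rw [← tensorTranslationₗ_apply, map_zero, smul_zero]

theorem coordProj_mul_mul (M : (𝓔 n) →L[ℂ] 𝓔 n) (i j : Fin n) (x : 𝓔 n) :
    (coordProj i * M * coordProj j) x =
      (x j * ⟪EuclideanSpace.single i (1 : ℂ), M (EuclideanSpace.single j 1)⟫_ℂ) •
        EuclideanSpace.single i 1 := by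
  have h : coordProj j x = x j • EuclideanSpace.single j (1 : ℂ) := rfl
  rw [mul_apply_eq_comp, mul_apply_eq_comp, h, map_smul, map_smul, mul_smul]
  congr 1
  rw [EuclideanSpace.inner_single_left]
  simp [coordProj]

/-! ### Schur multipliers on a Hilbert space with basis labelled by Γ -/

variable {ι K : Type*} [NormedAddCommGroup K] [InnerProductSpace ℂ K] [CompleteSpace K]

/-- Only finitely many basis vectors enter ξ and η. Compressing T and T' to their span gives
matrices to which the finite-dimensional Schur bound applies. -/
theorem IsCBMultiplierWith.norm_inner_le_of_orthonormal {φ : Γ → ℂ} {C : ℝ}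
    (hφ : IsCBMultiplierWith φ C) {b : ι → K} (hb : Orthonormal ℂ b) (g : ι → Γ)
    {T T' : K →L[ℂ] K}
    (h : ∀ i j, ⟪b i, T' (b j)⟫_ℂ = φ (g i * (g j)⁻¹) * ⟪b i, T (b j)⟫_ℂ) {ξ η : K}
    (hξ : ξ ∈ Submodule.span ℂ (Set.range b)) (hη : η ∈ Submodule.span ℂ (Set.range b)) :
    ‖⟪η, T' ξ⟫_ℂ‖ ≤ C * ‖T‖ * ‖ξ‖ * ‖η‖ := by
  classical
  obtain ⟨c, rfl⟩ := (Finsupp.mem_span_range_iff_exists_finsupp).1 hξ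
  obtain ⟨d, rfl⟩ := (Finsupp.mem_span_range_iff_exists_finsupp).1 hη
  let F : Finset ι := c.support ∪ d.support
  let n := F.card
  let f : Fin n → ι := fun k => (F.equivFin.symm k : ι)
  have hf : Function.Injective f := Subtype.val_injective.comp F.equivFin.symm.injective
  let e := EuclideanSpace.basisFun (Fin n) ℂ
  let U₀ : (𝓔 n) →ₗ[ℂ] K := e.toBasis.constr ℂ (b ∘ f)
  have hU₀ : U₀ ∘ e.toBasis = b ∘ f := by
    ext k
    exact e.toBasis.constr_basis ℂ (b ∘ f) k
  let U : (𝓔 n) →ₗᵢ[ℂ] K := U₀.isometryOfOrthonormal (v := e.toBasis)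
    (by rw [e.coe_toBasis]; exact e.orthonormal) (by rw [hU₀]; exact hb.comp f hf)
  have hUe : ∀ k, U (EuclideanSpace.single k 1) = b (f k) := by
    intro k
    have := congrFun hU₀ k
    simp only [Function.comp_apply, e, OrthonormalBasis.coe_toBasis,
      EuclideanSpace.basisFun_apply] at this
    exact this
  let V : (𝓔 n) →L[ℂ] K := U.toContinuousLinearMap
  have hV : ∀ x, V x = U x := fun _ => rfl
  have hVn : ‖V‖ ≤ 1 := U.norm_toContinuousLinearMap_le
  let comp : (K →L[ℂ] K) → ((𝓔 n) →L[ℂ] 𝓔 n) := fun S => V.adjoint ∘L S ∘L V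
  have hcomp : ∀ S x y, ⟪x, comp S y⟫_ℂ = ⟪U x, S (U y)⟫_ℂ := by
    intro S x y
    simp [comp, ContinuousLinearMap.adjoint_inner_right, hV]
  have hmat := hφ.norm_matrix_le (fun k => g (f k)) (M := comp T) (M' := comp T') (by
    intro i j
    ext1 x
    rw [smul_apply, coordProj_mul_mul, coordProj_mul_mul, hcomp, hcomp, hUe,
      hUe, h, smul_smul]
    congr 1
    ring)
  have hcompn : ‖comp T‖ ≤ ‖T‖ := by
    refine (ContinuousLinearMap.opNorm_comp_le _ _).trans ?_
    rw [LinearIsometryEquiv.norm_map]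
    calc ‖V‖ * ‖T ∘L V‖ ≤ 1 * (‖T‖ * 1) := by
          gcongr
          exact (ContinuousLinearMap.opNorm_comp_le _ _).trans (by gcongr)
      _ = ‖T‖ := by ring
  have hrange : ∀ c : ι →₀ ℂ, c.support ⊆ F → ∃ x, U x = c.sum fun i a => a • b i := by
    intro c hc
    refine ⟨∑ k, c (f k) • EuclideanSpace.single k (1 : ℂ), ?_⟩
    rw [map_sum, Finsupp.sum_of_support_subset c hc _ (by simp)]
    simp only [map_smul, hUe]
    rw [← Finset.sum_coe_sort F, ← F.equivFin.symm.sum_comp]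
  obtain ⟨x, hx⟩ := hrange c Finset.subset_union_left
  obtain ⟨y, hy⟩ := hrange d Finset.subset_union_right
  rw [← hx, ← hy, ← hcomp, U.norm_map, U.norm_map]
  calc ‖⟪y, comp T' x⟫_ℂ‖ ≤ ‖y‖ * ‖comp T' x‖ := norm_inner_le_norm _ _
    _ ≤ ‖y‖ * (‖comp T'‖ * ‖x‖) := by gcongr; exact ContinuousLinearMap.le_opNorm _ _
    _ ≤ ‖y‖ * ((C * ‖T‖) * ‖x‖) := by
      gcongr
      exact hmat.trans (mul_le_mul_of_nonneg_left hcompn hφ.nonneg)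
    _ = _ := by ring

theorem IsCBMultiplierWith.norm_le_of_hilbertBasis {φ : Γ → ℂ} {C : ℝ}
    (hφ : IsCBMultiplierWith φ C) (b : HilbertBasis ι ℂ K) (g : ι → Γ) {T T' : K →L[ℂ] K}
    (h : ∀ i j, ⟪b i, T' (b j)⟫_ℂ = φ (g i * (g j)⁻¹) * ⟪b i, T (b j)⟫_ℂ) :
    ‖T'‖ ≤ C * ‖T‖ := by
  have hd : Dense (Submodule.span ℂ (Set.range b) : Set K) := by
    rw [Submodule.dense_iff_topologicalClosure_eq_top]
    exact b.dense_span
  have hC : 0 ≤ C * ‖T‖ := mul_nonneg hφ.nonneg (norm_nonneg _)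
  have key : ∀ ξ η : K, ‖⟪η, T' ξ⟫_ℂ‖ ≤ C * ‖T‖ * ‖ξ‖ * ‖η‖ := by
    intro ξ η
    refine isClosed_property2 (e := ((↑) : Submodule.span ℂ (Set.range b) → K))
      (p := fun ξ η => ‖⟪η, T' ξ⟫_ℂ‖ ≤ C * ‖T‖ * ‖ξ‖ * ‖η‖) hd.denseRange_val
      (isClosed_le (by fun_prop) (by fun_prop)) (fun ξ η => ?_) ξ η
    exact hφ.norm_inner_le_of_orthonormal b.orthonormal g h ξ.2 η.2
  refine ContinuousLinearMap.opNorm_le_bound _ hC fun ξ => ?_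
  -- Testing the form bound against η = T'ξ turns it into an operator norm bound.
  have h1 := key ξ (T' ξ)
  rw [inner_self_eq_norm_sq_to_K] at h1
  have h2 : ‖T' ξ‖ * ‖T' ξ‖ ≤ C * ‖T‖ * ‖ξ‖ * ‖T' ξ‖ := by
    simpa [sq] using h1
  rcases (norm_nonneg (T' ξ)).eq_or_lt with h0 | h0
  · rw [← h0]
    positivity
  · exact le_of_mul_le_mul_right h2 h0

end Schur

/-! ### The regular representation of `C₀(Y)` and finite sums in the crossed product -/

/-- The Hilbert space `ℓ²(Γ, ℓ²(Y))`. -/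
abbrev RegSpace (Γ Y : Type*) : Type _ := L2 Γ (L2 Y ℂ)

/-- The bounded operators on `ℓ²(Γ, ℓ²(Y))`. -/
abbrev RegOp (Γ Y : Type*) : Type _ := RegSpace Γ Y →L[ℂ] RegSpace Γ Y

section Basis

variable {Γ Y : Type*}

open Classical in
/-- The basis vector `δ_t ⊗ δ_y` of `ℓ²(Γ, ℓ²(Y))`. -/
def regVec (i : Γ × Y) : RegSpace Γ Y := lp.single 2 i.1 (lp.single 2 i.2 1)

open Classical in
theorem regVec_apply (i : Γ × Y) (t : Γ) (y : Y) :
    (regVec i : RegSpace Γ Y) t y = if t = i.1 ∧ y = i.2 then 1 else 0 := by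
  rw [regVec, lp.single_apply]
  by_cases ht : t = i.1
  · subst ht
    simp [Pi.single_apply]
  · simp [ht]

theorem inner_regVec (i : Γ × Y) (ξ : RegSpace Γ Y) : ⟪regVec i, ξ⟫_ℂ = ξ i.1 i.2 := by
  classical
  have h := lp.inner_single_left (𝕜 := ℂ) i.1 (lp.single 2 i.2 (1 : ℂ)) ξ
  have h' := lp.inner_single_left (𝕜 := ℂ) i.2 (1 : ℂ) (ξ i.1)
  rw [regVec]
  convert h.trans h' using 1
  simp

theorem orthonormal_regVec : Orthonormal ℂ (regVec : Γ × Y → RegSpace Γ Y) := by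
  classical
  rw [orthonormal_iff_ite]
  intro i j
  rw [inner_regVec, regVec_apply]
  simp [Prod.ext_iff]

/-- The Hilbert basis `δ_t ⊗ δ_y` of `ℓ²(Γ, ℓ²(Y))`. -/
def regBasis : HilbertBasis (Γ × Y) ℂ (RegSpace Γ Y) :=
  HilbertBasis.mkOfOrthogonalEqBot orthonormal_regVec (by
    rw [Submodule.eq_bot_iff]
    intro ξ hξ
    ext t y
    have := (Submodule.mem_orthogonal _ _).1 hξ _ (Submodule.subset_span ⟨(t, y), rfl⟩)
    rwa [inner_regVec] at this)

theorem regBasis_apply (i : Γ × Y) : regBasis i = (regVec i : RegSpace Γ Y) := by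
  rw [regBasis, HilbertBasis.coe_mkOfOrthogonalEqBot]

end Basis

section Regular

variable (Γ Y : Type*) [Group Γ] [TopologicalSpace Y] [MulAction Γ Y] [ContinuousConstSMul Γ Y]

/-- The regular representation of `C₀(Y)` on `ℓ²(Γ, ℓ²(Y))`, as a *-homomorphism. -/
def regHom : C₀(Y, ℂ) →⋆ₙₐ[ℂ] RegOp Γ Y where
  toFun f := regularRep (functionAction Γ Y) (multiplicationRep Y) f
  map_smul' c f := by
    ext ξ t y
    simp [regularRep]
  map_zero' := by
    ext ξ t y
    simp [regularRep]
  map_add' f g := by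
    ext ξ t y
    simp [regularRep]
  map_mul' f g := by
    ext ξ t y
    simp [regularRep]
  map_star' f := by
    rw [ContinuousLinearMap.star_eq_adjoint, ContinuousLinearMap.eq_adjoint_iff]
    intro ξ η
    rw [lp.inner_eq_tsum, lp.inner_eq_tsum]
    refine tsum_congr fun t => ?_
    simp only [regularRep, lp.mapCLM_apply_coe, map_star]
    rw [ContinuousLinearMap.star_eq_adjoint, ContinuousLinearMap.adjoint_inner_left]

variable {Γ Y}

@[simp]
theorem regHom_apply (f : C₀(Y, ℂ)) (ξ : RegSpace Γ Y) (t : Γ) (y : Y) :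
    regHom Γ Y f ξ t y = f (t • y) * ξ t y := by
  change f (t⁻¹⁻¹ • y) * ξ t y = _
  rw [inv_inv]

theorem norm_regHom_le (f : C₀(Y, ℂ)) : ‖regHom Γ Y f‖ ≤ ‖f‖ :=
  NonUnitalStarAlgHom.norm_apply_le (regHom Γ Y) f

theorem continuous_regHom : Continuous (regHom Γ Y) :=
  AddMonoidHomClass.continuous_of_bound (regHom Γ Y) 1 fun f => by simpa using norm_regHom_le f

theorem functionAction_apply (s : Γ) (f : C₀(Y, ℂ)) (y : Y) :
    functionAction Γ Y s f y = f (s⁻¹ • y) := rfl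

theorem translation_mul_regHom (s : Γ) (f : C₀(Y, ℂ)) :
    translation s * regHom Γ Y f = regHom Γ Y (functionAction Γ Y s f) * translation s := by
  ext ξ t y
  simp [functionAction_apply, mul_smul]

theorem regHom_mul_translation_mul (s t : Γ) (f g : C₀(Y, ℂ)) :
    (regHom Γ Y f * translation s) * (regHom Γ Y g * translation t) =
      regHom Γ Y (f * functionAction Γ Y s g) * translation (s * t) := by
  rw [mul_assoc, ← mul_assoc (translation s), translation_mul_regHom, mul_assoc, translation_mul,
    map_mul, mul_assoc]

theorem star_regHom_mul_translation (s : Γ) (f : C₀(Y, ℂ)) :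
    star (regHom Γ Y f * translation s) =
      regHom Γ Y (functionAction Γ Y s⁻¹ (star f)) * translation s⁻¹ := by
  rw [star_mul, star_translation, ← map_star, translation_mul_regHom]

/-- The finite sum `∑ φ(s) b_s u_s` in the crossed product, for `b : Γ →₀ C₀(Y)`. -/
def weightedSum (φ : Γ → ℂ) : (Γ →₀ C₀(Y, ℂ)) →ₗ[ℂ] RegOp Γ Y :=
  Finsupp.lsum ℂ fun s => φ s • (LinearMap.mulRight ℂ (translation s : RegOp Γ Y)) ∘ₗ
    ((regHom Γ Y : C₀(Y, ℂ) →ₗ[ℂ] RegOp Γ Y))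

theorem weightedSum_eq (φ : Γ → ℂ) (b : Γ →₀ C₀(Y, ℂ)) :
    weightedSum φ b = b.sum fun s f => φ s • (regHom Γ Y f * translation s) := rfl

theorem weightedSum_single (φ : Γ → ℂ) (s : Γ) (f : C₀(Y, ℂ)) :
    weightedSum φ (Finsupp.single s f) = φ s • (regHom Γ Y f * translation s) := by
  rw [weightedSum, Finsupp.lsum_single]
  rfl

/-- The finite sum `∑ b_s u_s` in the crossed product, for `b : Γ →₀ C₀(Y)`. -/
def crossedSum : (Γ →₀ C₀(Y, ℂ)) →ₗ[ℂ] RegOp Γ Y := weightedSum fun _ => 1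

theorem crossedSum_eq (b : Γ →₀ C₀(Y, ℂ)) :
    crossedSum b = b.sum fun s f => regHom Γ Y f * translation s := by
  simp [crossedSum, weightedSum_eq]

theorem crossedSum_single (s : Γ) (f : C₀(Y, ℂ)) :
    crossedSum (Finsupp.single s f) = regHom Γ Y f * translation s := by
  rw [crossedSum, weightedSum_single, one_smul]

open Classical in
-- In the basis δ_t ⊗ δ_y the weight φ enters only as a Schur multiplier in the Γ-labels, and every
-- value of a coefficient b_s occurs as a matrix entry.
theorem inner_regVec_weightedSum (φ : Γ → ℂ) (b : Γ →₀ C₀(Y, ℂ)) (i j : Γ × Y) :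
    ⟪regVec i, weightedSum φ b (regVec j)⟫_ℂ =
      φ (i.1 * j.1⁻¹) * if i.2 = j.2 then b (i.1 * j.1⁻¹) (i.1 • i.2) else 0 := by
  induction b using Finsupp.induction_linear with
  | zero => simp
  | add b c hb hc =>
    rw [map_add, add_apply, inner_add_right, hb, hc, ← mul_add]
    split_ifs <;> simp
  | single s f =>
    rw [weightedSum_single, smul_apply, inner_smul_right, mul_apply_eq_comp, inner_regVec,
      regHom_apply, translation_apply, regVec_apply]
    have h : s⁻¹ * i.1 = j.1 ↔ s = i.1 * j.1⁻¹ := by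
      rw [inv_mul_eq_iff_eq_mul, eq_mul_inv_iff_mul_eq, eq_comm]
    by_cases hs : s = i.1 * j.1⁻¹
    · rw [h, ← hs, Finsupp.single_eq_same]
      by_cases hij : i.2 = j.2 <;> simp [hij]
    · rw [h, Finsupp.single_eq_of_ne (Ne.symm hs)]
      simp [hs]

/-- Completely bounded multipliers act boundedly on the crossed product. -/
theorem IsCBMultiplierWith.norm_weightedSum_le {φ : Γ → ℂ} {C : ℝ} (hφ : IsCBMultiplierWith φ C)
    (b : Γ →₀ C₀(Y, ℂ)) : ‖weightedSum φ b‖ ≤ C * ‖crossedSum b‖ := by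
  classical
  -- The basis vector δ_t ⊗ δ_y is labelled by t; the label map need not be injective.
  refine hφ.norm_le_of_hilbertBasis regBasis (fun i => i.1) fun i j => ?_
  rw [regBasis_apply, regBasis_apply, inner_regVec_weightedSum, crossedSum,
    inner_regVec_weightedSum, one_mul]

/-- The value b_s(y) is a matrix entry between the unit vectors at (1, y) and (s⁻¹, y). This
replaces the conditional expectation onto C₀(Y). -/
theorem norm_coeff_le (b : Γ →₀ C₀(Y, ℂ)) (s : Γ) : ‖b s‖ ≤ ‖crossedSum b‖ := by
  classical
  rw [← ZeroAtInftyContinuousMap.norm_toBCF_eq_norm]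
  refine (BoundedContinuousFunction.norm_le (norm_nonneg _)).2 fun y => ?_
  have h : (b s) y = ⟪regVec (1, y), crossedSum b (regVec (s⁻¹, y))⟫_ℂ := by
    rw [crossedSum, inner_regVec_weightedSum]
    simp
  change ‖(b s) y‖ ≤ _
  rw [h]
  refine (norm_inner_le_norm _ _).trans ?_
  have h1 : ∀ i : Γ × Y, ‖(regVec i : RegSpace Γ Y)‖ = 1 := fun i => orthonormal_regVec.1 i
  have h2 := (crossedSum b).le_opNorm (regVec (s⁻¹, y))
  rw [h1, mul_one] at h2
  rwa [h1, one_mul]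

end Regular

/-! ### Crossed products by invariant subalgebras of `C₀(Y)` -/

section Crossed

variable {Γ Y : Type*} [Group Γ] [TopologicalSpace Y] [MulAction Γ Y] [ContinuousConstSMul Γ Y]

variable (Γ) in
/-- The crossed product of a C*-subalgebra of `C₀(Y)`, as a C*-subalgebra of the operators
on `ℓ²(Γ, ℓ²(Y))`. -/
def crossed (C : CStarSubalgebra C₀(Y, ℂ)) : CStarSubalgebra (RegOp Γ Y) :=
  CStarSubalgebra.generate {x | ∃ c ∈ C.1, ∃ s : Γ, regHom Γ Y c * translation s = x}

theorem crossed_le {C : CStarSubalgebra C₀(Y, ℂ)} {A : CStarSubalgebra (RegOp Γ Y)} :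
    crossed Γ C ≤ A ↔ ∀ c ∈ C.1, ∀ s : Γ, regHom Γ Y c * translation s ∈ A.1 := by
  rw [crossed, CStarSubalgebra.generate_le]
  constructor
  · exact fun h c hc s => h ⟨c, hc, s, rfl⟩
  · rintro h _ ⟨c, hc, s, rfl⟩
    exact h c hc s

theorem regHom_mul_translation_mem_crossed {C : CStarSubalgebra C₀(Y, ℂ)} {c : C₀(Y, ℂ)}
    (hc : c ∈ C.1) (s : Γ) : regHom Γ Y c * translation s ∈ (crossed Γ C).1 :=
  crossed_le.1 le_rfl c hc s

theorem regHom_mem_crossed {C : CStarSubalgebra C₀(Y, ℂ)} {c : C₀(Y, ℂ)} (hc : c ∈ C.1) :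
    regHom Γ Y c ∈ (crossed Γ C).1 := by
  simpa [translation_one] using regHom_mul_translation_mem_crossed hc (1 : Γ)

theorem crossed_mono {C D : CStarSubalgebra C₀(Y, ℂ)} (h : C ≤ D) : crossed Γ C ≤ crossed Γ D :=
  crossed_le.2 fun _ hc s => regHom_mul_translation_mem_crossed (h hc) s

/-- By invariance of C, the monomials c u_s are closed under products and adjoints, so their linear
span is already the generated *-algebra. -/
theorem exists_crossedSum_near {C : CStarSubalgebra C₀(Y, ℂ)}
    (hC : ∀ (s : Γ), ∀ a ∈ C.1, functionAction Γ Y s a ∈ C.1) {x : RegOp Γ Y}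
    (hx : x ∈ (crossed Γ C).1) {ε : ℝ} (hε : 0 < ε) :
    ∃ b : Γ →₀ C₀(Y, ℂ), (∀ s, b s ∈ C.1) ∧ ‖x - crossedSum b‖ < ε := by
  let S : Set (RegOp Γ Y) := {x | ∃ c ∈ C.1, ∃ s : Γ, regHom Γ Y c * translation s = x}
  have hstar : star S ⊆ S := by
    intro x hx
    obtain ⟨c, hc, s, h⟩ := hx
    refine ⟨_, hC s⁻¹ _ (star_mem hc), s⁻¹, ?_⟩
    rw [← star_regHom_mul_translation, h, star_star]
  let P : Subsemigroup (RegOp Γ Y) :=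
    { carrier := S
      mul_mem' := by
        rintro _ _ ⟨c, hc, s, rfl⟩ ⟨d, hd, t, rfl⟩
        exact ⟨_, mul_mem hc (hC s d hd), s * t, (regHom_mul_translation_mul s t c d).symm⟩ }
  let N : Submodule ℂ (Γ →₀ C₀(Y, ℂ)) :=
    { carrier := {b | ∀ s, b s ∈ C.1}
      zero_mem' := fun s => zero_mem C.1
      add_mem' := fun hb hc s => add_mem (hb s) (hc s)
      smul_mem' := fun c b hb s => SMulMemClass.smul_mem c (hb s) }
  have hspan : (NonUnitalStarAlgebra.adjoin ℂ S).toSubmodule ≤ N.map crossedSum := by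
    rw [NonUnitalStarAlgebra.adjoin_eq_span, Submodule.span_le]
    have h1 : Subsemigroup.closure (S ∪ star S) ≤ P :=
      Subsemigroup.closure_le.2 (Set.union_subset le_rfl hstar)
    intro x hx
    obtain ⟨c, hc, s, rfl⟩ := h1 hx
    refine ⟨Finsupp.single s c, fun t => ?_, crossedSum_single s c⟩
    classical
    rw [Finsupp.single_apply]
    split_ifs
    · exact hc
    · exact zero_mem C.1
  have hx' : x ∈ closure ((NonUnitalStarAlgebra.adjoin ℂ S : NonUnitalStarSubalgebra ℂ _) :
      Set (RegOp Γ Y)) := hx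
  obtain ⟨y, hy, hxy⟩ := Metric.mem_closure_iff.1 hx' ε hε
  obtain ⟨b, hb, rfl⟩ := hspan hy
  exact ⟨b, hb, by rwa [← dist_eq_norm]⟩

/-- Approximate f = f u₁ by a finite sum with coefficients in C; by contractivity its coefficient at
1 approximates f. -/
theorem mem_of_regHom_mem_crossed {C : CStarSubalgebra C₀(Y, ℂ)}
    (hC : ∀ (s : Γ), ∀ a ∈ C.1, functionAction Γ Y s a ∈ C.1) {f : C₀(Y, ℂ)}
    (hf : regHom Γ Y f ∈ (crossed Γ C).1) : f ∈ C.1 := by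
  have : f ∈ closure (C.1 : Set C₀(Y, ℂ)) := by
    refine Metric.mem_closure_iff.2 fun ε hε => ?_
    obtain ⟨b, hb, hfb⟩ := exists_crossedSum_near hC hf hε
    refine ⟨b 1, hb 1, ?_⟩
    have h1 : regHom Γ Y f = crossedSum (Finsupp.single 1 f) := by
      rw [crossedSum_single, translation_one, mul_one]
    rw [h1, ← map_sub] at hfb
    have h2 := norm_coeff_le (Finsupp.single 1 f - b) 1
    rw [Finsupp.sub_apply, Finsupp.single_eq_same] at h2
    rw [dist_eq_norm]
    exact h2.trans_lt hfb
  rwa [C.2.closure_eq] at this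

/-- Equivariance of g identifies the regular representation of C₀(W) with the restriction of that of
C₀(Y). -/
theorem factorCrossedProduct_eq {W : Type*} [TopologicalSpace W] [MulAction Γ W]
    [ContinuousConstSMul Γ W] (g : CocompactMap Y W) (hg : Function.Surjective g)
    (hs : ∀ (s : Γ) (y : Y), g (s • y) = s • g y) :
    factorCrossedProduct Γ g = crossed Γ (functionAlgebra g hg) := by
  have key : ∀ f : C₀(W, ℂ),
      regularRep (functionAction Γ W) ((multiplicationRep Y).comp (pullback g)) f =
        regHom Γ Y (pullback g f) := by
    intro f
    ext ξ t y
    rw [regHom_apply]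
    change f (t⁻¹⁻¹ • g y) * ξ t y = f (g (t • y)) * ξ t y
    rw [inv_inv, hs]
  rw [factorCrossedProduct, reducedCrossedProduct, crossed]
  congr 1
  ext x
  constructor
  · rintro ⟨⟨f, s⟩, rfl⟩
    exact ⟨pullback g f, ⟨f, rfl⟩, s, by simp only [key]⟩
  · rintro ⟨_, ⟨f, rfl⟩, s, rfl⟩
    exact ⟨(f, s), by simp only [key]; rfl⟩

end Crossed

/-! ### Partitions of unity subordinate to a free action -/

section Partition

variable {Γ X : Type*} [Group Γ] [TopologicalSpace X] [T2Space X] [MulAction Γ X]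
  [ContinuousConstSMul Γ X]

theorem exists_wandering_nhds (hα : ∀ (s : Γ) (x : X), s • x = x → s = 1) (F : Finset Γ) (x : X) :
    ∃ U ∈ 𝓝 x, ∀ s ∈ F, s ≠ 1 → ∀ z ∈ U, s⁻¹ • z ∉ U := by
  -- The condition passes to smaller sets, so phrasing it along `smallSets` allows the finitely many
  -- s to be treated separately.
  have h : ∀ s ∈ F, ∀ᶠ U in (𝓝 x).smallSets, s ≠ 1 → ∀ z ∈ U, s⁻¹ • z ∉ U := by
    intro s _
    by_cases hs : s = 1
    · exact Eventually.of_forall fun U h => absurd hs h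
    have hne : x ≠ s⁻¹ • x := fun h => hs (by simpa using hα s⁻¹ x h.symm)
    obtain ⟨V, hV, W, hW, hVW⟩ := Filter.disjoint_iff.1 (disjoint_nhds_nhds.2 hne)
    -- V and W are disjoint neighbourhoods of x and s⁻¹x. If z and s⁻¹z both lie in the set below,
    -- then s⁻¹z ∈ V ∩ W.
    refine (eventually_smallSets' fun U U' hU h hs z hz hz' => h hs z (hU hz) (hU hz')).2
      ⟨V ∩ (fun z => s⁻¹ • z) ⁻¹' W,
        inter_mem hV ((continuous_const_smul s⁻¹).continuousAt hW), fun _ z hz hz' => ?_⟩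
    exact Set.disjoint_left.1 hVW hz'.1 hz.2
  have h' := (F.eventually_all).2 h
  obtain ⟨U, hU, hU'⟩ := (eventually_smallSets' (fun U U' hU h s hs hs1 z hz hz' =>
    h s hs hs1 z (hU hz) (hU hz'))).1 h'
  exact ⟨U, hU, hU'⟩

/-- Square roots of a partition of unity subordinate to wandering neighbourhoods. Roots are taken
because the hᵢ will multiply from both sides. -/
theorem exists_partition [LocallyCompactSpace X] (hα : ∀ (s : Γ) (x : X), s • x = x → s = 1)
    (F : Finset Γ) {K : Set X} (hK : IsCompact K) :
    ∃ (n : ℕ) (h : Fin n → C₀(X, ℂ)), (∀ i, star (h i) = h i) ∧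
      (∀ x, ∃ r ∈ Set.Icc (0 : ℝ) 1, ∑ i, h i x * h i x = r) ∧
      (∀ x ∈ K, ∑ i, h i x * h i x = 1) ∧
      ∀ i, ∀ s ∈ F, s ≠ 1 → ∀ x, h i x * h i (s⁻¹ • x) = 0 := by
  choose U hU hUF using exists_wandering_nhds hα F
  obtain ⟨t, -, ht⟩ := hK.elim_nhds_subcover (fun x => interior (U x))
    fun x _ => interior_mem_nhds.2 (hU x)
  let e : Fin t.card → X := fun i => t.equivFin.symm i
  obtain ⟨f, hfs, hf1, hf01, hfc⟩ := exists_continuous_sum_one_of_isOpen_isCompact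
    (s := fun i => interior (U (e i))) (fun i => isOpen_interior) hK (by
      intro x hx
      obtain ⟨z, hz, hxz⟩ := Set.mem_iUnion₂.1 (ht hx)
      exact Set.mem_iUnion.2 ⟨t.equivFin ⟨z, hz⟩, by simpa [e] using hxz⟩)
  -- Off K the fᵢ may sum to more than 1; dividing by this maximum bounds the sum by 1 and changes
  -- nothing on K.
  let m : X → ℝ := fun x => max 1 (∑ i, f i x)
  have hm : Continuous m := by fun_prop
  have hm1 : ∀ x, 1 ≤ m x := fun x => le_max_left _ _
  have hm0 : ∀ x, 0 < m x := fun x => one_pos.trans_le (hm1 x)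
  let g : Fin t.card → X → ℝ := fun i x => √(f i x / m x)
  have hg : ∀ i, Continuous (g i) := fun i =>
    Real.continuous_sqrt.comp ((f i).continuous.div hm fun x => (hm0 x).ne')
  have hg0 : ∀ i x, f i x = 0 → g i x = 0 := fun i x h => by simp [g, h]
  have hgc : ∀ i, HasCompactSupport fun x => (g i x : ℂ) := fun i =>
    (hfc i).mono fun x hx h => hx (by simp [hg0 i x h])
  have hgg : ∀ i x, (g i x : ℂ) * g i x = ((f i x / m x : ℝ) : ℂ) := by
    intro i x
    rw [← Complex.ofReal_mul, Real.mul_self_sqrt (div_nonneg (hf01 i x).1 (hm0 x).le)]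
  let h : Fin t.card → C₀(X, ℂ) := fun i =>
    ⟨⟨fun x => (g i x : ℂ), Complex.continuous_ofReal.comp (hg i)⟩, (hgc i).is_zero_at_infty⟩
  have hsum : ∀ x, ∑ i, h i x * h i x = (((∑ i, f i x) / m x : ℝ) : ℂ) := by
    intro x
    rw [Finset.sum_div, Complex.ofReal_sum]
    exact Finset.sum_congr rfl fun i _ => hgg i x
  refine ⟨t.card, h, fun i => ?_, fun x => ⟨_, ⟨?_, ?_⟩, hsum x⟩, fun x hx => ?_, ?_⟩
  · ext x
    exact Complex.conj_ofReal _
  · exact div_nonneg (Finset.sum_nonneg fun i _ => (hf01 i x).1) (hm0 x).le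
  · exact (div_le_one (hm0 x)).2 (le_max_right _ _)
  · have h1 : ∑ i, f i x = 1 := by simpa using hf1 hx
    rw [hsum]
    simp [m, h1]
  · intro i s hs hs1 x
    have hsupp : ∀ z, h i z ≠ 0 → z ∈ U (e i) := by
      intro z hz
      refine interior_subset (hfs i (subset_tsupport _ fun h0 => hz ?_))
      change ((g i z : ℝ) : ℂ) = 0
      rw [hg0 i z h0, Complex.ofReal_zero]
    by_contra hne
    exact hUF (e i) s hs hs1 x (hsupp x (left_ne_zero_of_mul hne))
      (hsupp _ (right_ne_zero_of_mul hne))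

end Partition

/-! ### Averaging operators -/

/-- The column with entries aᵢ is a contraction from H to a finite power of H, and the sum
compresses the diagonal operator T by it; Cauchy–Schwarz makes this concrete. -/
theorem norm_sum_star_mul_mul_le {H ι : Type*} [NormedAddCommGroup H] [InnerProductSpace ℂ H]
    [CompleteSpace H] [Fintype ι] (a : ι → H →L[ℂ] H) (ha : ‖∑ i, star (a i) * a i‖ ≤ 1)
    (T : H →L[ℂ] H) : ‖∑ i, star (a i) * T * a i‖ ≤ ‖T‖ := by
  have hsq : ∀ ξ, ∑ i, ‖a i ξ‖ ^ 2 ≤ ‖ξ‖ ^ 2 := by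
    intro ξ
    have h1 : ((∑ i, ‖a i ξ‖ ^ 2 : ℝ) : ℂ) = ⟪ξ, (∑ i, star (a i) * a i) ξ⟫_ℂ := by
      rw [sum_apply, inner_sum, Complex.ofReal_sum]
      refine Finset.sum_congr rfl fun i _ => ?_
      rw [mul_apply_eq_comp, ContinuousLinearMap.star_eq_adjoint,
        ContinuousLinearMap.adjoint_inner_right, inner_self_eq_norm_sq_to_K]
      simp
    have h2 : ‖((∑ i, ‖a i ξ‖ ^ 2 : ℝ) : ℂ)‖ ≤ ‖ξ‖ * (1 * ‖ξ‖) := by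
      rw [h1]
      refine (norm_inner_le_norm _ _).trans ?_
      gcongr
      exact ContinuousLinearMap.le_of_opNorm_le _ ha ξ
    rw [Complex.norm_real, Real.norm_of_nonneg (by positivity)] at h2
    linarith
  refine ContinuousLinearMap.opNorm_le_bound _ (norm_nonneg T) fun ξ => ?_
  set η := (∑ i, star (a i) * T * a i) ξ with hη
  have h1 : ‖η‖ ^ 2 ≤ ‖T‖ * (‖ξ‖ * ‖η‖) := by
    have h2 : ⟪η, η⟫_ℂ = ∑ i, ⟪a i η, T (a i ξ)⟫_ℂ := by
      conv_lhs =>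
        right
        rw [hη, sum_apply]
      rw [inner_sum]
      refine Finset.sum_congr rfl fun i _ => ?_
      rw [mul_apply_eq_comp, mul_apply_eq_comp, ContinuousLinearMap.star_eq_adjoint,
        ContinuousLinearMap.adjoint_inner_right]
    have h3 : ‖⟪η, η⟫_ℂ‖ = ‖η‖ ^ 2 := by
      rw [inner_self_eq_norm_sq_to_K]
      simp
    rw [← h3, h2]
    calc ‖∑ i, ⟪a i η, T (a i ξ)⟫_ℂ‖ ≤ ∑ i, ‖⟪a i η, T (a i ξ)⟫_ℂ‖ := norm_sum_le _ _
      _ ≤ ∑ i, ‖T‖ * (‖a i ξ‖ * ‖a i η‖) := by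
        refine Finset.sum_le_sum fun i _ => (norm_inner_le_norm _ _).trans ?_
        calc ‖a i η‖ * ‖T (a i ξ)‖ ≤ ‖a i η‖ * (‖T‖ * ‖a i ξ‖) := by
              gcongr
              exact T.le_opNorm _
          _ = _ := by ring
      _ = ‖T‖ * ∑ i, ‖a i ξ‖ * ‖a i η‖ := by rw [Finset.mul_sum]
      _ ≤ ‖T‖ * (‖ξ‖ * ‖η‖) := by
        gcongr
        refine (Real.sum_mul_le_sqrt_mul_sqrt _ _ _).trans ?_
        gcongr
        · exact Real.sqrt_le_iff.2 ⟨norm_nonneg _, hsq ξ⟩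
        · exact Real.sqrt_le_iff.2 ⟨norm_nonneg _, hsq η⟩
  rcases (norm_nonneg η).eq_or_lt with h0 | h0
  · rw [← h0]
    positivity
  · exact le_of_mul_le_mul_right (by linarith) h0

/-! ### Coefficients of elements of intermediate algebras -/

theorem norm_le_of_forall {Y : Type*} [TopologicalSpace Y] {f : C₀(Y, ℂ)} {r : ℝ} (hr : 0 ≤ r)
    (h : ∀ y, ‖f y‖ ≤ r) : ‖f‖ ≤ r := by
  rw [← ZeroAtInftyContinuousMap.norm_toBCF_eq_norm]
  exact (BoundedContinuousFunction.norm_le hr).2 h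

theorem zeroAtInfty_sum_apply {Y ι : Type*} [TopologicalSpace Y] (s : Finset ι) (f : ι → C₀(Y, ℂ))
    (y : Y) : (∑ i ∈ s, f i) y = ∑ i ∈ s, f i y := by
  classical
  induction s using Finset.induction_on with
  | empty => simp
  | insert a s ha ih => simp [Finset.sum_insert ha, ih]

section Coefficients

variable {Γ X Y : Type*} [Group Γ] [TopologicalSpace X]
  [TopologicalSpace Y] [MulAction Γ X] [MulAction Γ Y] (π : ProperFactorMap Γ Y X)

/-- The compact set is taken in X, so that functions pulled back from X can serve as cutoffs for f.
-/
theorem exists_isCompact_norm_lt (f : C₀(Y, ℂ)) {ε : ℝ} (hε : 0 < ε) :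
    ∃ K : Set X, IsCompact K ∧ ∀ y, π.toFun y ∉ K → ‖f y‖ < ε := by
  obtain ⟨L, hL, hLf⟩ := mem_cocompact.1 (Metric.tendsto_nhds.1 (zero_at_infty f) ε hε)
  refine ⟨π.toFun '' L, hL.image π.isFactorMap.isQuotientMap.continuous, fun y hy => ?_⟩
  simpa using hLf fun h => hy ⟨y, h, rfl⟩

variable [T2Space X]

/-- The C*-subalgebra `C₀(X) ⊆ C₀(Y)` of a proper factor map. -/
abbrev ProperFactorMap.algebra : CStarSubalgebra C₀(Y, ℂ) :=
  functionAlgebra π.toCocompactMap π.isFactorMap.isQuotientMap.surjective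

theorem pullback_mem_algebra (f : C₀(X, ℂ)) : pullback π.toCocompactMap f ∈ π.algebra.1 := ⟨f, rfl⟩

variable [LocallyCompactSpace X] [ContinuousConstSMul Γ X] [ContinuousConstSMul Γ Y]

/-- The pulled-back partition has two uses: ∑ pᵢ² is an approximate unit at f, and the last
condition annihilates terms with unwanted group elements. -/
theorem exists_localizing (hα : ∀ (s : Γ) (x : X), s • x = x → s = 1) (F : Finset Γ)
    (f : C₀(Y, ℂ)) {ε : ℝ} (hε : 0 < ε) :
    ∃ (n : ℕ) (p : Fin n → C₀(Y, ℂ)), (∀ i, p i ∈ π.algebra.1) ∧ (∀ i, star (p i) = p i) ∧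
      ‖∑ i, p i * p i‖ ≤ 1 ∧ ‖f * ∑ i, p i * p i - f‖ ≤ ε ∧
      ∀ i, ∀ s ∈ F, s ≠ 1 → p i * functionAction Γ Y s (p i) = 0 := by
  obtain ⟨K, hK, hKf⟩ := exists_isCompact_norm_lt π f hε
  obtain ⟨n, h, hstar, h01, h1, hF⟩ := exists_partition hα F hK
  have hp : ∀ i y, pullback π.toCocompactMap (h i) y = h i (π.toFun y) := fun _ _ => rfl
  refine ⟨n, fun i => pullback π.toCocompactMap (h i), fun i => pullback_mem_algebra π _,
    fun i => by rw [← map_star, hstar], ?_, ?_, fun i s hs hs1 => ?_⟩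
  · refine norm_le_of_forall zero_le_one fun y => ?_
    obtain ⟨r, hr, hr'⟩ := h01 (π.toFun y)
    rw [zeroAtInfty_sum_apply]
    simp only [ZeroAtInftyContinuousMap.mul_apply, hp]
    rw [hr', Complex.norm_real, Real.norm_of_nonneg hr.1]
    exact hr.2
  · refine norm_le_of_forall hε.le fun y => ?_
    rw [ZeroAtInftyContinuousMap.sub_apply, ZeroAtInftyContinuousMap.mul_apply,
      zeroAtInfty_sum_apply]
    simp only [ZeroAtInftyContinuousMap.mul_apply, hp]
    by_cases hy : π.toFun y ∈ K
    · rw [h1 _ hy, mul_one, sub_self, norm_zero]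
      exact hε.le
    · obtain ⟨r, hr, hr'⟩ := h01 (π.toFun y)
      have e : f y * (r : ℂ) - f y = ((r - 1 : ℝ) : ℂ) * f y := by
        push_cast
        ring
      rw [hr', e, norm_mul, Complex.norm_real]
      have : ‖r - 1‖ ≤ 1 := by
        rw [Real.norm_eq_abs, abs_le]
        constructor <;> linarith [hr.1, hr.2]
      calc ‖r - 1‖ * ‖f y‖ ≤ 1 * ε := by
            gcongr
            exact (hKf y hy).le
        _ = ε := one_mul ε
  · ext y
    have := hF i s hs hs1 (π.toFun y)
    rw [← π.isFactorMap.map_smul] at this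
    exact this

/-- This is where freeness isolates a coefficient. The map Ψ(x) = ∑ pᵢ x u_s* pᵢ is contractive and
sends a into A, while from the finite sum it retains only b_s ∑ pᵢ². One ε pays for replacing a by
the sum, the other for ∑ pᵢ² not being a unit. -/
theorem exists_mem_near_coeff (hα : ∀ (s : Γ) (x : X), s • x = x → s = 1)
    {A : CStarSubalgebra (RegOp Γ Y)} (hA : crossed Γ π.algebra ≤ A) {a : RegOp Γ Y}
    (ha : a ∈ A.1) {b : Γ →₀ C₀(Y, ℂ)} {ε : ℝ} (hε : 0 < ε) (hab : ‖a - crossedSum b‖ ≤ ε)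
    (s : Γ) : ∃ a' ∈ A.1, ‖a' - regHom Γ Y (b s)‖ ≤ 2 * ε := by
  classical
  -- Right multiplication by u_s* turns the t-th term into one carrying t s⁻¹, hence the shifted
  -- support.
  obtain ⟨n, p, hpA, hps, hp1, hpf, hpF⟩ :=
    exists_localizing π hα (b.support.image (· * s⁻¹)) (b s) hε
  let Ψ : RegOp Γ Y → RegOp Γ Y := fun x =>
    ∑ i, star (regHom Γ Y (p i)) * (x * translation s⁻¹) * regHom Γ Y (p i)
  have hrs : ∀ i, star (regHom Γ Y (p i)) = regHom Γ Y (p i) := fun i => by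
    rw [← map_star, hps]
  have hΨ : ∀ x, ‖Ψ x‖ ≤ ‖x‖ := by
    intro x
    refine (norm_sum_star_mul_mul_le _ ?_ _).trans (le_of_eq ?_)
    · simp only [hrs, ← map_mul, ← map_sum]
      exact (norm_regHom_le _).trans hp1
    · exact norm_mul_translation x s⁻¹
  have hΨsub : ∀ x y, Ψ (x - y) = Ψ x - Ψ y := by
    intro x y
    simp only [Ψ, sub_mul, mul_sub, Finset.sum_sub_distrib]
  have hΨb : Ψ (crossedSum b) = regHom Γ Y (b s * ∑ i, p i * p i) := by
    have hterm : ∀ i t (f : C₀(Y, ℂ)), star (regHom Γ Y (p i)) *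
        (regHom Γ Y f * translation t * translation s⁻¹) * regHom Γ Y (p i) =
        regHom Γ Y (f * (p i * functionAction Γ Y (t * s⁻¹) (p i))) * translation (t * s⁻¹) := by
      intro i t f
      rw [hrs, mul_assoc (regHom Γ Y f), translation_mul, mul_assoc, mul_assoc,
        translation_mul_regHom, ← mul_assoc, ← mul_assoc, ← map_mul, ← map_mul]
      rw [mul_comm (p i) f, mul_assoc]
    simp only [Ψ]
    rw [Finset.mul_sum, map_sum]
    refine Finset.sum_congr rfl fun i _ => ?_
    rw [crossedSum_eq, Finsupp.sum, Finset.sum_mul, Finset.mul_sum, Finset.sum_mul]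
    simp only [hterm]
    rw [Finset.sum_eq_single s]
    · have h1 : functionAction Γ Y (1 : Γ) (p i) = p i := by
        ext y
        simp [functionAction_apply]
      rw [mul_inv_cancel, translation_one, mul_one, h1]
    · intro t ht hts
      rw [hpF i (t * s⁻¹) (Finset.mem_image_of_mem _ ht) (by rwa [Ne, mul_inv_eq_one]), mul_zero,
        map_zero, zero_mul]
    · intro hs
      rw [Finsupp.notMem_support_iff.1 hs, zero_mul, map_zero, zero_mul]
  refine ⟨Ψ a, sum_mem fun i _ => ?_, ?_⟩
  -- The factor u_s* pᵢ is the adjoint of pᵢ u_s, an element of the crossed product of C₀(X); u_s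
  -- alone need not lie in A.
  · rw [mul_assoc, mul_assoc, translation_mul_regHom, hrs]
    refine mul_mem (hA (regHom_mem_crossed (hpA i))) (mul_mem ha ?_)
    rw [← translation_mul_regHom, ← hps i, map_star]
    have := star_mem (hA (regHom_mul_translation_mem_crossed (hpA i) s))
    rwa [star_mul, star_translation] at this
  · have h1 : Ψ a - regHom Γ Y (b s) =
        Ψ (a - crossedSum b) + regHom Γ Y (b s * ∑ i, p i * p i - b s) := by
      rw [hΨsub, hΨb, map_sub]
      abel
    rw [h1, two_mul]
    exact (norm_add_le _ _).trans
      (add_le_add ((hΨ _).trans hab) ((norm_regHom_le _).trans hpf))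

/-- C₀(X) contains approximate units for C₀(Y) and A is closed. This stands in for a unit: products
with a bare u_s can be tested after inserting a function from X. -/
theorem regHom_mul_translation_mem_of_forall (hα : ∀ (s : Γ) (x : X), s • x = x → s = 1)
    {A : CStarSubalgebra (RegOp Γ Y)} {f : C₀(Y, ℂ)} {s : Γ}
    (h : ∀ p ∈ π.algebra.1, regHom Γ Y (f * p) * translation s ∈ A.1) :
    regHom Γ Y f * translation s ∈ A.1 := by
  have : regHom Γ Y f * translation s ∈ closure (A.1 : Set (RegOp Γ Y)) := by
    refine Metric.mem_closure_iff.2 fun ε hε => ?_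
    obtain ⟨n, p, hpA, -, -, hpf, -⟩ := exists_localizing π hα ∅ f (half_pos hε)
    have hmem : ∑ i, p i * p i ∈ π.algebra.1 := sum_mem fun i _ => mul_mem (hpA i) (hpA i)
    refine ⟨regHom Γ Y (f * ∑ i, p i * p i) * translation s, h _ hmem, ?_⟩
    have e : regHom Γ Y (f * ∑ i, p i * p i) * translation s - regHom Γ Y f * translation s =
        regHom Γ Y (f * ∑ i, p i * p i - f) * translation s := by
      rw [map_sub (regHom Γ Y), sub_mul]
    rw [dist_eq_norm', e, norm_mul_translation]
    exact ((norm_regHom_le _).trans hpf).trans_lt (half_lt_self hε)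
  rwa [A.2.closure_eq] at this

variable (Γ) in
/-- The C*-algebra of functions in `C₀(Y)` that belong to a given algebra of operators
on `ℓ²(Γ, ℓ²(Y))`. -/
def functionsIn (A : CStarSubalgebra (RegOp Γ Y)) : CStarSubalgebra C₀(Y, ℂ) :=
  ⟨A.1.comap (regHom Γ Y), A.2.preimage continuous_regHom⟩

theorem mem_functionsIn {A : CStarSubalgebra (RegOp Γ Y)} {f : C₀(Y, ℂ)} :
    f ∈ (functionsIn Γ A).1 ↔ regHom Γ Y f ∈ A.1 := Iff.rfl

theorem crossed_functionsIn_le (hα : ∀ (s : Γ) (x : X), s • x = x → s = 1)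
    {A : CStarSubalgebra (RegOp Γ Y)} (hA : crossed Γ π.algebra ≤ A) :
    crossed Γ (functionsIn Γ A) ≤ A := by
  refine crossed_le.2 fun c hc s => regHom_mul_translation_mem_of_forall π hα fun p hp => ?_
  rw [map_mul, mul_assoc]
  exact mul_mem hc (hA (regHom_mul_translation_mem_crossed hp s))

/-- Invariance should follow from α_s(c) = u_s c u_s*, but u_s need not lie in A. The two
translations are absorbed separately, each together with an element of C₀(X). -/
theorem functionsIn_mem_intermediateAlgebras (hα : ∀ (s : Γ) (x : X), s • x = x → s = 1)
    {A : CStarSubalgebra (RegOp Γ Y)} (hA : crossed Γ π.algebra ≤ A) :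
    functionsIn Γ A ∈ intermediateAlgebras π := by
  refine ⟨fun f hf => hA (regHom_mem_crossed hf), fun s c hc => ?_⟩
  -- Left translation: p α_s(c) u_s = (p u_s) c.
  have h1 : regHom Γ Y (functionAction Γ Y s c) * translation s ∈ A.1 := by
    refine regHom_mul_translation_mem_of_forall π hα fun p hp => ?_
    rw [mul_comm, map_mul, mul_assoc, ← translation_mul_regHom, ← mul_assoc]
    exact mul_mem (hA (regHom_mul_translation_mem_crossed hp s)) hc
  -- Right translation: α_s(c) u_s · (p* u_s)* = α_s(c) p.
  have h2 : regHom Γ Y (functionAction Γ Y s c) * translation (1 : Γ) ∈ A.1 := by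
    refine regHom_mul_translation_mem_of_forall π hα fun p hp => ?_
    have h3 := star_mem (hA (regHom_mul_translation_mem_crossed (star_mem hp) s))
    rw [star_mul, star_translation, map_star, star_star] at h3
    have h4 := mul_mem h1 h3
    rw [mul_assoc, ← mul_assoc (translation s), translation_mul, mul_inv_cancel, translation_one,
      one_mul, ← map_mul] at h4
    rwa [translation_one, mul_one]
  rwa [translation_one, mul_one] at h2

end Coefficients

/-! ### The approximation property and membership in crossed products -/

/-- Hahn–Banach in the quotient E/S, where closedness of S makes the class of a have nonzero norm.
-/
theorem exists_dual_of_notMem {E : Type*} [NormedAddCommGroup E] [NormedSpace ℂ E]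
    {S : Submodule ℂ E} (hS : IsClosed (S : Set E)) {a : E} (ha : a ∉ S) :
    ∃ ω : E →L[ℂ] ℂ, ω a ≠ 0 ∧ ∀ x ∈ S, ω x = 0 := by
  have : IsClosed (S : Set E) := hS
  have h0 : S.mkQ a ≠ 0 := fun h => ha ((Submodule.Quotient.mk_eq_zero S).1 h)
  obtain ⟨g, -, hg⟩ := exists_dual_vector ℂ (S.mkQ a) (norm_ne_zero_iff.2 h0)
  refine ⟨g ∘L S.mkQL, ?_, fun x hx => ?_⟩
  · change g (S.mkQ a) ≠ 0
    rw [hg]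
    simpa using h0
  · change g (S.mkQ x) = 0
    have hx0 : S.mkQ x = 0 := (Submodule.Quotient.mk_eq_zero S).2 hx
    rw [hx0, map_zero]

section Approximation

variable {Γ Y : Type*} [Group Γ] [TopologicalSpace Y] [MulAction Γ Y] [ContinuousConstSMul Γ Y]

/-- The functional `φ ↦ ω(∑ φ(s) b_s u_s)` on the completely bounded multipliers. -/
def coeffFunctional (ω : RegOp Γ Y →L[ℂ] ℂ) (b : Γ →₀ C₀(Y, ℂ)) : cbMultipliers Γ →ₗ[ℂ] ℂ where
  toFun φ := ω (weightedSum φ.1 b)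
  map_add' φ ψ := by
    rw [← map_add]
    congr 1
    simp [weightedSum_eq, Finsupp.sum, add_smul, Finset.sum_add_distrib]
  map_smul' c φ := by
    rw [RingHom.id_apply, ← map_smul]
    congr 1
    simp [weightedSum_eq, Finsupp.sum, mul_smul, Finset.smul_sum]

theorem coeffFunctional_apply (ω : RegOp Γ Y →L[ℂ] ℂ) (b : Γ →₀ C₀(Y, ℂ)) (φ : cbMultipliers Γ) :
    coeffFunctional ω b φ = ω (weightedSum φ.1 b) := rfl

/-- The flexible F permits summing over the support of b (to see an ℓ¹ function) or of φ (to have a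
finite index set independent of b). -/
theorem coeffFunctional_eq_sum (ω : RegOp Γ Y →L[ℂ] ℂ) (b : Γ →₀ C₀(Y, ℂ)) (φ : cbMultipliers Γ)
    {F : Finset Γ} (hF : ∀ s ∉ F, φ.1 s * ω (regHom Γ Y (b s) * translation s) = 0) :
    coeffFunctional ω b φ = ∑ s ∈ F, φ.1 s * ω (regHom Γ Y (b s) * translation s) := by
  classical
  rw [coeffFunctional_apply, weightedSum_eq, Finsupp.sum, map_sum]
  simp only [map_smul, smul_eq_mul]
  rw [Finset.sum_subset (Finset.subset_union_left (s₁ := b.support) (s₂ := F)),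
    Finset.sum_subset (Finset.subset_union_right (s₁ := b.support) (s₂ := F))]
  · exact fun s _ hs => hF s hs
  · intro s _ hs
    rw [Finsupp.notMem_support_iff.1 hs, map_zero, zero_mul, map_zero, mul_zero]

/-- Operator norm convergence of finite sums thus forces convergence of the functionals in the norm
defining Q(Γ). -/
theorem norm_coeffFunctional_sub_le (ω : RegOp Γ Y →L[ℂ] ℂ) (b c : Γ →₀ C₀(Y, ℂ))
    (φ : cbMultipliers Γ) {C : ℝ} (hφ : IsCBMultiplierWith φ.1 C) :
    ‖coeffFunctional ω b φ - coeffFunctional ω c φ‖ ≤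
      ‖ω‖ * (C * ‖crossedSum b - crossedSum c‖) := by
  rw [coeffFunctional_apply, coeffFunctional_apply, ← map_sub, ← map_sub, ← map_sub]
  exact (ω.le_opNorm _).trans
    (mul_le_mul_of_nonneg_left (hφ.norm_weightedSum_le _) (norm_nonneg ω))

/-- If `Γ` has the approximation property, then a limit of finite sums whose coefficients
converge to elements of `D` belongs to the crossed product of `D`. -/
theorem HasAP.mem_crossed (hΓ : HasAP Γ) {D : CStarSubalgebra C₀(Y, ℂ)} {a : RegOp Γ Y}
    {b : ℕ → Γ →₀ C₀(Y, ℂ)} (hb : Tendsto (fun n => crossedSum (b n)) atTop (𝓝 a))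
    {e : Γ → C₀(Y, ℂ)} (he : ∀ s, Tendsto (fun n => b n s) atTop (𝓝 (e s)))
    (heD : ∀ s, e s ∈ D.1) : a ∈ (crossed Γ D).1 := by
  by_contra ha
  obtain ⟨ω, hωa, hω⟩ := exists_dual_of_notMem
    (S := (crossed Γ D).1.toNonUnitalSubalgebra.toSubmodule) (crossed Γ D).2 ha
  have hcau : ∀ φ : cbMultipliers Γ, ∃ z, Tendsto (fun n => coeffFunctional ω (b n) φ) atTop
      (𝓝 z) := by
    intro φ
    obtain ⟨C, hC⟩ := φ.2
    refine cauchySeq_tendsto_of_complete (Metric.cauchySeq_iff'.2 fun ε hε => ?_)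
    have hpos : 0 < ‖ω‖ * C + 1 := by
      have := mul_nonneg (norm_nonneg ω) hC.nonneg
      linarith
    obtain ⟨N, hN⟩ := Metric.cauchySeq_iff'.1 hb.cauchySeq _ (div_pos hε hpos)
    refine ⟨N, fun n hn => ?_⟩
    have h1 := hN n hn
    rw [dist_eq_norm, lt_div_iff₀ hpos] at h1
    rw [dist_eq_norm]
    refine (norm_coeffFunctional_sub_le ω (b n) (b N) φ hC).trans_lt (lt_of_le_of_lt ?_ h1)
    have := norm_nonneg (crossedSum (b n) - crossedSum (b N))
    linarith
  choose q₀ hq₀ using hcau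
  -- This is φ ↦ ω(M_φ a), obtained as a limit because multipliers have been applied only to finite
  -- sums.
  let q : cbMultipliers Γ →ₗ[ℂ] ℂ :=
    linearMapOfTendsto q₀ (fun n => coeffFunctional ω (b n)) (tendsto_pi_nhds.2 hq₀)
  have hq : ∀ φ, Tendsto (fun n => coeffFunctional ω (b n) φ) atTop (𝓝 (q φ)) := hq₀
  have hqle : ∀ n (φ : cbMultipliers Γ) C, IsCBMultiplierWith φ.1 C →
      ‖q φ - coeffFunctional ω (b n) φ‖ ≤ ‖ω‖ * (C * ‖a - crossedSum (b n)‖) := by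
    intro n φ C hC
    refine le_of_tendsto_of_tendsto' ((hq φ).sub_const _).norm
      (((hb.sub_const _).norm.const_mul C).const_mul ‖ω‖) fun m => ?_
    exact norm_coeffFunctional_sub_le ω (b m) (b n) φ hC
  have hpre : IsPredualFunctional q := by
    intro ε hε
    have h1 : Tendsto (fun n => ‖ω‖ * ‖a - crossedSum (b n)‖) atTop (𝓝 0) := by
      have := ((tendsto_const_nhds (x := a)).sub hb).norm.const_mul ‖ω‖
      simpa using this
    obtain ⟨n, hn⟩ := (h1.eventually (gt_mem_nhds hε)).exists
    have hz : ∀ s ∉ (b n).support, ω (regHom Γ Y (b n s) * translation s) = 0 := by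
      intro s hs
      rw [Finsupp.notMem_support_iff.1 hs, map_zero, zero_mul, map_zero]
    -- The approximating ℓ¹ function s ↦ ω(b_n(s) u_s) is finitely supported, and its error is at
    -- most ‖ω‖ C ‖a - ∑ b_n(s) u_s‖.
    refine ⟨fun s => ω (regHom Γ Y (b n s) * translation s),
      summable_of_ne_finset_zero (s := (b n).support) fun s hs => by
        simp only [hz s hs, norm_zero],
      fun φ C hC => ?_⟩
    have h2 : ∑' s, ω (regHom Γ Y (b n s) * translation s) * φ.1 s = coeffFunctional ω (b n) φ := by
      rw [coeffFunctional_eq_sum ω (b n) φ (F := (b n).support) fun s hs => by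
        rw [hz s hs, mul_zero], tsum_eq_sum (s := (b n).support) fun s hs => by
        rw [hz s hs, zero_mul]]
      exact Finset.sum_congr rfl fun s _ => mul_comm _ _
    rw [h2]
    refine (hqle n φ C hC).trans ?_
    have := mul_le_mul_of_nonneg_right hn.le hC.nonneg
    linarith
  -- For finitely supported φ the limit passes through the sum, leaving the values ω(e_s u_s), which
  -- vanish since e_s ∈ D.
  have hfin : ∀ φ : cbMultipliers Γ, (Function.support φ.1).Finite → q φ = 0 := by
    intro φ hφ
    have hF : ∀ n, coeffFunctional ω (b n) φ =
        ∑ s ∈ hφ.toFinset, φ.1 s * ω (regHom Γ Y (b n s) * translation s) := fun n =>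
      coeffFunctional_eq_sum ω (b n) φ fun s hs => by
        have : φ.1 s = 0 := by simpa using hs
        rw [this, zero_mul]
    have hlim : Tendsto (fun n => coeffFunctional ω (b n) φ) atTop
        (𝓝 (∑ s ∈ hφ.toFinset, φ.1 s * ω (regHom Γ Y (e s) * translation s))) := by
      simp only [hF]
      refine tendsto_finsetSum _ fun s _ => Tendsto.const_mul _ ?_
      exact (ω.continuous.tendsto _).comp (((continuous_regHom.tendsto _).comp (he s)).mul_const _)
    rw [tendsto_nhds_unique (hq φ) hlim]
    refine Finset.sum_eq_zero fun s _ => ?_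
    rw [hω _ (regHom_mul_translation_mem_crossed (heD s) s), mul_zero]
  obtain ⟨l, hl, hlfin, hlq⟩ := hΓ
  have h1 : q (cbOne Γ) = 0 :=
    tendsto_nhds_unique (hlq q hpre)
      (tendsto_const_nhds.congr' (hlfin.mono fun φ hφ => (hfin φ hφ).symm))
  -- For φ = 1 the weighted sums are the unweighted ones, which converge to a.
  have h2 : q (cbOne Γ) = ω a := tendsto_nhds_unique (hq (cbOne Γ)) ((ω.continuous.tendsto a).comp hb)
  exact hωa (h2.symm.trans h1)

end Approximation

/-! ### The lattice isomorphism -/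

section Main

variable {Γ X Y : Type*} [Group Γ] [TopologicalSpace X] [T2Space X] [LocallyCompactSpace X]
  [TopologicalSpace Y] [MulAction Γ X] [ContinuousConstSMul Γ X] [MulAction Γ Y]
  [ContinuousConstSMul Γ Y]

/-- Approximants of a have convergent coefficients by contractivity, freeness places the limits in
A, and the AP then returns a to the crossed product of A ∩ C₀(Y). -/
theorem HasAP.crossed_functionsIn (hΓ : HasAP Γ) (hα : ∀ (s : Γ) (x : X), s • x = x → s = 1)
    (π : ProperFactorMap Γ Y X) {A : CStarSubalgebra (RegOp Γ Y)}
    (hA : crossed Γ π.algebra ≤ A) {B : CStarSubalgebra C₀(Y, ℂ)}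
    (hB : ∀ (s : Γ), ∀ a ∈ B.1, functionAction Γ Y s a ∈ B.1) (hAB : A ≤ crossed Γ B) :
    crossed Γ (functionsIn Γ A) = A := by
  refine le_antisymm (crossed_functionsIn_le π hα hA) fun a ha => ?_
  have hpos : ∀ n : ℕ, (0 : ℝ) < 1 / ((n : ℝ) + 1) := fun n => Nat.one_div_pos_of_nat
  -- Membership of the approximating coefficients in B is dropped: only their limits need to lie in
  -- A.
  choose b _ hb using fun n : ℕ => exists_crossedSum_near hB (hAB ha) (hpos n)
  have hlim : Tendsto (fun n => crossedSum (b n)) atTop (𝓝 a) := by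
    rw [tendsto_iff_norm_sub_tendsto_zero]
    refine squeeze_zero (fun _ => norm_nonneg _) (fun n => ?_)
      (tendsto_one_div_add_atTop_nhds_zero_nat (𝕜 := ℝ))
    rw [norm_sub_rev]
    exact (hb n).le
  have hcoeff : ∀ s, ∃ f, Tendsto (fun n => b n s) atTop (𝓝 f) := by
    intro s
    refine cauchySeq_tendsto_of_complete (Metric.cauchySeq_iff'.2 fun ε hε => ?_)
    obtain ⟨N, hN⟩ := Metric.cauchySeq_iff'.1 hlim.cauchySeq ε hε
    refine ⟨N, fun n hn => ?_⟩
    have h1 := norm_coeff_le (b n - b N) s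
    rw [map_sub crossedSum, Finsupp.sub_apply] at h1
    rw [dist_eq_norm]
    refine h1.trans_lt ?_
    rw [← dist_eq_norm]
    exact hN n hn
  choose e he using hcoeff
  refine hΓ.mem_crossed hlim he fun s => ?_
  rw [mem_functionsIn]
  choose a' ha' hab' using fun n =>
    exists_mem_near_coeff π hα hA ha (hpos n) (hb n).le s
  have h1 : Tendsto a' atTop (𝓝 (regHom Γ Y (e s))) := by
    have h2 : Tendsto (fun n => a' n - regHom Γ Y (b n s)) atTop (𝓝 0) := by
      refine squeeze_zero_norm hab' ?_
      simpa using (tendsto_one_div_add_atTop_nhds_zero_nat (𝕜 := ℝ)).const_mul 2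
    have h3 : Tendsto (fun n => regHom Γ Y (b n s)) atTop (𝓝 (regHom Γ Y (e s))) :=
      (continuous_regHom.tendsto _).comp (he s)
    simpa using h2.add h3
  exact A.2.mem_of_tendsto h1 (Eventually.of_forall ha')

/-- The isomorphism between intermediate `Γ`-C*-algebras and intermediate algebras of crossed
products. -/
def crossedOrderIso (hΓ : HasAP Γ) (hα : ∀ (s : Γ) (x : X), s • x = x → s = 1)
    (π : ProperFactorMap Γ Y X) {B : CStarSubalgebra C₀(Y, ℂ)}
    (hB : ∀ (s : Γ), ∀ a ∈ B.1, functionAction Γ Y s a ∈ B.1) (hBtop : ∀ a, a ∈ B.1) :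
    intermediateAlgebras π ≃o Set.Icc (crossed Γ π.algebra) (crossed Γ B) where
  toFun C := ⟨crossed Γ C.1, crossed_mono C.2.1, crossed_mono fun a _ => hBtop a⟩
  invFun A := ⟨functionsIn Γ A.1, functionsIn_mem_intermediateAlgebras π hα A.2.1⟩
  left_inv C := Subtype.ext <| Subtype.ext <| SetLike.ext fun _ =>
    ⟨fun h => mem_of_regHom_mem_crossed C.2.2 h, fun h => regHom_mem_crossed h⟩
  right_inv A := Subtype.ext <| hΓ.crossed_functionsIn hα π A.2.1 hB A.2.2
  map_rel_iff' {_ D} := ⟨fun h _ hc => mem_of_regHom_mem_crossed D.2.2 (h (regHom_mem_crossed hc)),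
    fun h => crossed_mono h⟩

end Main

end

end CrossedExt

/-! ### The main theorem -/

open CrossedExt
theorem theorem2p3 {Γ X Y : Type*} [Group Γ] (hΓ : HasAP Γ)
    [TopologicalSpace X] [T2Space X] [LocallyCompactSpace X]
    [TopologicalSpace Y] [T2Space Y] [LocallyCompactSpace Y]
    [MulAction Γ X] [ContinuousConstSMul Γ X] [MulAction Γ Y] [ContinuousConstSMul Γ Y]
    (hα : ∀ (s : Γ) (x : X), s • x = x → s = 1) (hβ : ∀ (s : Γ) (y : Y), s • y = y → s = 1)
    (π : ProperFactorMap Γ Y X) :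
    ∃ Φ : ExtensionClass π ≃o
        Set.Icc (factorCrossedProduct Γ π.toCocompactMap)
          (factorCrossedProduct Γ (CocompactMap.id Y)),
      (∀ Z : IntermediateExtension π,
        (Φ (Quotient.mk _ Z)).1 = factorCrossedProduct Γ Z.toCocompactMap) ∧
      (∀ a b, Φ (a ⊔ b) = Φ a ⊔ Φ b) ∧ ∀ a b, Φ (a ⊓ b) = Φ a ⊓ Φ b := by
  have hX : factorCrossedProduct Γ π.toCocompactMap = crossed Γ π.algebra :=
    factorCrossedProduct_eq _ _ π.isFactorMap.map_smul
  have hY : factorCrossedProduct Γ (CocompactMap.id Y) =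
      crossed Γ (functionAlgebra (CocompactMap.id Y) Function.surjective_id) :=
    factorCrossedProduct_eq _ _ fun _ _ => rfl
  have htop : ∀ a, a ∈ (functionAlgebra (CocompactMap.id Y) Function.surjective_id).1 :=
    fun a => ⟨a, rfl⟩
  rw [hX, hY]
  -- The order on extension classes is defined through Gelfand duality, so compatibility holds by
  -- definition.
  let G : ExtensionClass π ≃o intermediateAlgebras π :=
    { ExtensionClass.gelfand π with map_rel_iff' := Iff.rfl }
  let Φ := G.trans (crossedOrderIso hΓ hα π (fun s a _ => htop _) htop)
  refine ⟨Φ, fun Z => ?_, fun a b => OrderIso.map_sup Φ a b, fun a b => OrderIso.map_inf Φ a b⟩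
  exact (factorCrossedProduct_eq Z.toCocompactMap Z.isFactorMap_p.isQuotientMap.surjective
    Z.isFactorMap_p.map_smul).symm
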